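/- **Setting.** Let $\epsilon,s,T>0$ and let $(p,q)$ be one of the pairs $(1,0)$, $(1,-1)$. For $\alpha\in(1,2)$ put $g_0^{(\alpha)}=1$, $g_k^{(\alpha)}=\bigl(1-\tfrac{\alpha+1}{k}\bigr)g_{k-1}^{(\alpha)}$ for $k\ge 1$, and define $\omega_k=\omega_k^{(\alpha)}$ as follows. If $(p,q)=(1,0)$: $\omega_0=\tfrac{\alpha}{2}g_0^{(\alpha)}$ and $\omega_k=\tfrac{\alpha}{2}g_k^{(\alpha)}+\tfrac{2-\alpha}{2}g_{k-1}^{(\alpha)}$ for $k\ge1$. If $(p,q)=(1,-1)$: $\omega_k=\tfrac{\alpha+2}{4}g_k^{(\alpha)}$ for $k=0,1$ and $\omega_k=\tfrac{\alpha+2}{4}g_k^{(\alpha)}+\tfrac{2-\alpha}{4}g_{k-2}^{(\alpha)}$ for $k\ge2$. Let $\mathcal G_{\alpha,M}=[\omega_{i-j+1}]_{i,j=1}^M$ (with $\omega_k=0$ for $k<0$) and $G_{\alpha,M}=\mathcal G_{\alpha,M}+\mathcal G_{\alpha,M}^T$. For a symmetric Toeplitz matrix $T_M$ with first column $c=[c_0,\dots,c_{M-1}]$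 let $\tau(T_M)=T_M-H$, where $H$ is the $M\times M$ Hankel matrix with first column $\sigma^2(c)=[c_2,\dots,c_{M-1},0,0]$ and last row equal to $\sigma^2(c)$ in reversed order ($H=0$ if $M=1$). (These matrices are diagonalized by the discrete sine transform.) For $h>0$ and $h_t>0$ let $\overline c_\alpha(h)=-\bigl(2h^\alpha\cos(\alpha\pi/2)\bigr)^{-1}$ and $\gamma_\alpha(h_t,h)=h_t\,\overline c_\alpha(h)>0$. *1D.* Let $\alpha\in(1,2)$ and $a<b$. With $h_x=\frac{b-a}{M+1}$, $h_t=\frac TN$, $\overline c_\alpha=\overline c_\alpha(h_x)$, $\gamma=\gamma_\alpha(h_t,h_x)$, define $$A=(1+sh_t)I_M-\epsilon^2h_t\overline c_\alpha G_{\alpha,M},\quad P=(1+sh_t)I_M-\epsilon^2h_t\overline c_\alpha\,\tau(G_{\alpha,M}),\quad \hat A=\gamma^{-1}A,\quad \hat P=\gamma^{-1}P .$$ *2D.* Let $\alpha_1,\alpha_2\in(1,2)$, $a_1<b_1$, $a_2<b_2$. With $h_{x_j}=\frac{b_j-a_j}{M_j+1}$, $h_t=\frac TN$, $\overline c_{\alpha_j}=\overline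 c_{\alpha_j}(h_{x_j})$, $\gamma=\max_{j}\gamma_{\alpha_j}(h_t,h_{x_j})$, define $$A=(1+sh_t)I_{M_1M_2}-\epsilon^2h_t\bigl(\overline c_{\alpha_1}G_{\alpha_1,M_1}\otimes I_{M_2}+I_{M_1}\otimes\overline c_{\alpha_2}G_{\alpha_2,M_2}\bigr),$$ $$P=(1+sh_t)I_{M_1M_2}-\epsilon^2h_t\bigl(\overline c_{\alpha_1}\tau(G_{\alpha_1,M_1})\otimes I_{M_2}+I_{M_1}\otimes\overline c_{\alpha_2}\tau(G_{\alpha_2,M_2})\bigr),$$ and $\hat A=\gamma^{-1}A$, $\hat P=\gamma^{-1}P$. **Asymptotic notions.** Let $X_k$ be square matrices of size $d_k$, with eigenvalues $\mu_1(X_k),\dots,\mu_{d_k}(X_k)$ counted with algebraic multiplicity. For a measurable $f:D\to\mathbb C$ on a measurable set $D\subset\mathbb R^d$ of positive finite measure, $\{X_k\}\sim_\lambda(f,D)$ means that $\frac1{d_k}\sum_jF(\mu_j(X_k))\to\frac1{|D|}\int_DF(f(t))\,dt$ for every continuous compactly supported $F$ on $\mathbb C$; $\{X_k\}\sim_\lambda0$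 is the case $f=0$ (on $D=[-\pi,\pi]^d$, $d$ the space dimension). $\{X_k\}$ is *weakly clustered at* $1$ if for every $\delta>0$ the number of $j$ with $|\mu_j(X_k)-1|\ge\delta$ is $o(d_k)$. **Theorem 5.1.** In the 1D case let $(M(k))_k$ and $(N(k))_k$ be any sequences of positive integers tending to infinity, and in the 2D case let $(M_1(k))_k$, $(M_2(k))_k$ and $(N(k))_k$ be any sequences of positive integers tending to infinity. Let $A_k,P_k,\hat A_k,\hat P_k$ be the matrices above with $M=M(k)$ (respectively $M_j=M_j(k)$) and $N=N(k)$. Then, in each of the two cases, whatever the asymptotic behaviour of $\gamma$ (which may in particular tend to a finite limit or to $\infty$): 1. $\{A_k-P_k\}_k\sim_\lambda0$ and $\{\hat A_k-\hat P_k\}_k\sim_\lambda0$; 2. $P_k$ and $\hat P_k$ are invertible for all sufficiently large $k$, and $\{P_k^{-1}A_k\}_k$ and $\{\hat P_k^{-1}\hat A_k\}_k$ are weakly clustered at $1$. -/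

import Mathlib

open Filter Topology MeasureTheory
open scoped Kronecker

noncomputable section

namespace SFAC

/-! ### Asymptotic spectral notions for matrix-sequences -/

/-- The eigenvalues of a complex square matrix, listed with algebraic multiplicity. -/
def eigs {n : Type*} [Fintype n] [DecidableEq n] (A : Matrix n n ℂ) : Multiset ℂ :=
  A.charpoly.roots

/-- A real matrix regarded as a complex one. -/
def toComplex {n : Type*} (A : Matrix n n ℝ) : Matrix n n ℂ :=
  A.map (fun x : ℝ => (x : ℂ))

/-- Eigenvalue distribution `{A_k} ∼_λ (f, D)`, for `f` measurable on a set `D ⊆ ℝ^d` of positive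
finite measure: for every continuous compactly supported `F` on `ℂ`, the average of `F` over the
eigenvalues of `A_k` tends to the mean of `F ∘ f` over `D`. -/
def SpectrallyDistributed {I : ℕ → Type*} [∀ k, Fintype (I k)] [∀ k, DecidableEq (I k)]
    (A : ∀ k, Matrix (I k) (I k) ℂ) {d : ℕ} (f : (Fin d → ℝ) → ℂ) (D : Set (Fin d → ℝ)) : Prop :=
  ∀ F : ℂ → ℂ, Continuous F → HasCompactSupport F →
    Tendsto (fun k => (Fintype.card (I k) : ℂ)⁻¹ * ((eigs (A k)).map F).sum) atTop
      (𝓝 (((volume.real D)⁻¹ : ℝ) * ∫ t in D, F (f t)))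

/-- The cube `[-π, π]^d`. -/
def cube (d : ℕ) : Set (Fin d → ℝ) := Set.Icc (fun _ => -Real.pi) (fun _ => Real.pi)

/-- `{A_k} ∼_λ 0`: the distribution relation with the zero function as symbol. Matrices with a
`d`-level structure are given the domain `[-π, π]^d`. -/
def ZeroDistributed {I : ℕ → Type*} [∀ k, Fintype (I k)] [∀ k, DecidableEq (I k)]
    (d : ℕ) (A : ∀ k, Matrix (I k) (I k) ℂ) : Prop :=
  SpectrallyDistributed A (fun _ : Fin d → ℝ => (0 : ℂ)) (cube d)

open Classical in
/-- Weak clustering at `z` (in the sense of the eigenvalues): for every `δ > 0` the number of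
eigenvalues of `A_k` outside the open disk of centre `z` and radius `δ`, counted with multiplicity,
is `o(size of A_k)`. -/
def WeaklyClusteredAt {I : ℕ → Type*} [∀ k, Fintype (I k)] [∀ k, DecidableEq (I k)]
    (A : ∀ k, Matrix (I k) (I k) ℂ) (z : ℂ) : Prop :=
  ∀ δ : ℝ, 0 < δ →
    Tendsto (fun k => ((eigs (A k)).countP (fun μ => δ ≤ ‖μ - z‖) : ℝ) / Fintype.card (I k))
      atTop (𝓝 0)

/-! ### Grünwald weights and the Toeplitz matrices of the scheme -/

/-- The two admissible shift pairs `(p, q) = (1, 0)` and `(p, q) = (1, -1)`. -/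
inductive Shift
  | oneZero
  | oneNegOne

/-- Grünwald-Letnikov coefficients: `g 0 = 1`, `g k = (1 - (α + 1) / k) * g (k - 1)`. -/
def grunwald (α : ℝ) : ℕ → ℝ
  | 0 => 1
  | k + 1 => (1 - (α + 1) / ((k : ℝ) + 1)) * grunwald α k

/-- The weights `ω_k` of the weighted and shifted Grünwald difference formula. -/
def weight : Shift → ℝ → ℕ → ℝ
  | .oneZero, α, 0 => α / 2 * grunwald α 0
  | .oneZero, α, k + 1 => α / 2 * grunwald α (k + 1) + (2 - α) / 2 * grunwald α k
  | .oneNegOne, α, 0 => (α + 2) / 4 * grunwald α 0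
  | .oneNegOne, α, 1 => (α + 2) / 4 * grunwald α 1
  | .oneNegOne, α, k + 2 => (α + 2) / 4 * grunwald α (k + 2) + (2 - α) / 4 * grunwald α k

/-- The lower Hessenberg Toeplitz matrix with `(i, j)` entry `ω_{i - j + 1}` (and `0` if the index
is negative). -/
def calG (σ : Shift) (α : ℝ) (M : ℕ) : Matrix (Fin M) (Fin M) ℝ :=
  Matrix.of fun i j => if (j : ℕ) ≤ i + 1 then weight σ α (i + 1 - j) else 0

/-- The symmetric Toeplitz matrix `G_{α,M} = 𝒢_{α,M} + 𝒢_{α,M}ᵀ`. -/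
def symG (σ : Shift) (α : ℝ) (M : ℕ) : Matrix (Fin M) (Fin M) ℝ :=
  calG σ α M + (calG σ α M).transpose

/-! ### The `τ` approximation of a Toeplitz matrix -/

/-- First column of a square matrix. -/
def firstCol {M : ℕ} (T : Matrix (Fin M) (Fin M) ℝ) : Fin M → ℝ :=
  fun i => T i ⟨0, i.pos⟩

/-- `σ²(c) = [c_2, …, c_{M-1}, 0, 0]` for `c = [c_0, …, c_{M-1}]`. -/
def shiftTwo {M : ℕ} (c : Fin M → ℝ) : Fin M → ℝ :=
  fun k => if h : (k : ℕ) + 2 < M then c ⟨k + 2, h⟩ else 0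

/-- The flip `J v` of a vector. -/
def flip {M : ℕ} (v : Fin M → ℝ) : Fin M → ℝ := fun k => v k.rev

/-- The Hankel matrix with first column `c` and last row `r` (where `c_{M-1} = r_0`). -/
def hankel {M : ℕ} (c r : Fin M → ℝ) : Matrix (Fin M) (Fin M) ℝ :=
  Matrix.of fun i j =>
    if h : (i : ℕ) + j < M then c ⟨i + j, h⟩ else r ⟨i + j - (M - 1), by omega⟩

/-- `τ(T) = T - H(σ²(c), J σ²(c))`, where `c` is the first column of `T`. -/
def tau {M : ℕ} (T : Matrix (Fin M) (Fin M) ℝ) : Matrix (Fin M) (Fin M) ℝ :=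
  T - hankel (shiftTwo (firstCol T)) (flip (shiftTwo (firstCol T)))

/-! ### Coefficient matrices and preconditioners -/

/-- Space step `(b - a) / (M + 1)`. -/
def spaceStep (a b : ℝ) (M : ℕ) : ℝ := (b - a) / ((M : ℝ) + 1)

/-- Time step `T / N`. -/
def timeStep (T : ℝ) (N : ℕ) : ℝ := T / (N : ℝ)

/-- `c̄_α = -(2 h^α cos(α π / 2))⁻¹`. -/
def cbar (α h : ℝ) : ℝ := -(2 * h ^ α * Real.cos (α * Real.pi / 2))⁻¹

/-- `γ(h_t, h) = - h_t / (2 h^α cos(α π / 2))`. -/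
def gam (α ht h : ℝ) : ℝ := -ht / (2 * h ^ α * Real.cos (α * Real.pi / 2))

/-- One-dimensional coefficient matrix
`A_{α,M} = (1 + s h_t) I - ε² h_t c̄_α G_{α,M}`. -/
def coeff1 (σ : Shift) (ε s α ht h : ℝ) (M : ℕ) : Matrix (Fin M) (Fin M) ℝ :=
  (1 + s * ht) • (1 : Matrix (Fin M) (Fin M) ℝ) - (ε ^ 2 * ht * cbar α h) • symG σ α M

/-- One-dimensional `τ` preconditioner
`P_{α,M} = (1 + s h_t) I - ε² h_t c̄_α τ(G_{α,M})`. -/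
def prec1 (σ : Shift) (ε s α ht h : ℝ) (M : ℕ) : Matrix (Fin M) (Fin M) ℝ :=
  (1 + s * ht) • (1 : Matrix (Fin M) (Fin M) ℝ) - (ε ^ 2 * ht * cbar α h) • tau (symG σ α M)

/-- Two-dimensional coefficient matrix
`(1 + s h_t) I - ε² h_t (c̄_{α₁} G_{α₁,M₁} ⊗ I + I ⊗ c̄_{α₂} G_{α₂,M₂})`. -/
def coeff2 (σ : Shift) (ε s α₁ α₂ ht h₁ h₂ : ℝ) (M₁ M₂ : ℕ) :
    Matrix (Fin M₁ × Fin M₂) (Fin M₁ × Fin M₂) ℝ :=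
  (1 + s * ht) • (1 : Matrix (Fin M₁ × Fin M₂) (Fin M₁ × Fin M₂) ℝ) -
    (ε ^ 2 * ht) •
      ((cbar α₁ h₁ • symG σ α₁ M₁) ⊗ₖ (1 : Matrix (Fin M₂) (Fin M₂) ℝ) +
        (1 : Matrix (Fin M₁) (Fin M₁) ℝ) ⊗ₖ (cbar α₂ h₂ • symG σ α₂ M₂))

/-- Two-dimensional `τ` preconditioner: each `G` of `coeff2` is replaced by `τ(G)`. -/
def prec2 (σ : Shift) (ε s α₁ α₂ ht h₁ h₂ : ℝ) (M₁ M₂ : ℕ) :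
    Matrix (Fin M₁ × Fin M₂) (Fin M₁ × Fin M₂) ℝ :=
  (1 + s * ht) • (1 : Matrix (Fin M₁ × Fin M₂) (Fin M₁ × Fin M₂) ℝ) -
    (ε ^ 2 * ht) •
      ((cbar α₁ h₁ • tau (symG σ α₁ M₁)) ⊗ₖ (1 : Matrix (Fin M₂) (Fin M₂) ℝ) +
        (1 : Matrix (Fin M₁) (Fin M₁) ℝ) ⊗ₖ (cbar α₂ h₂ • tau (symG σ α₂ M₂)))

end SFAC

end

namespace SFAC

open Matrix Finset

/-! The difference `A - P` is a scaled Hankel correction, and it is concentrated in two opposite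
corners: in row i its entries are coefficients c_{i+j+2} and c_{2M-i-j} of the symmetric Toeplitz
matrix. The absolute tails of c from index m on are O(m^{-α}). After removing the columns within
ηM/2 of either end, the remaining row and column sums are therefore O(M^{-α}) times the scaling. The
scaling is o(M^α) in both normalisations. Unscaled, it is ε²h_t c̄ with c̄ = O(M^α) and h_t → 0;
after division by γ it is bounded, whatever γ does. So the corrections are `Negligible`, and this
property passes to Kronecker sums.

Negligibility controls eigenvalues through the Schur test. A symmetric Z with ‖(Z - c)v‖ < δ‖v‖ for
all nonzero v in the range of a linear map on a d-dimensional space has at least d eigenvalues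
within δ of c. With c = 0 and bounded test functions, this gives the zero distribution.

For the preconditioned matrices the key is P ≥ I. Write P = BᵀB. Then P⁻¹A has the characteristic
polynomial of the symmetric matrix B⁻ᵀAB⁻¹, and B⁻ᵀ is a contraction, so negligibility of `A - P`
gives clustering at 1 with no quantitative bound on P.

P ≥ I reduces to -τ(G) ≥ 0. Instead of diagonalising by sines, extend x to an odd function y on the
cyclic group of order 2(M+1). The form 2xᵀτ(G)x then equals c_0 R(0) + 2Σ c_k R(k), with R the
autocorrelation of y. Since R(k) = R(0) - D_k/2 with D_k = ‖y(·+k) - y‖², signs of c and of its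
partial sums suffice. -/

/-! ### Counting eigenvalues near a point -/

lemma dotProduct_self_orthogonal {n : Type*} [Fintype n] [DecidableEq n] {U : Matrix n n ℝ}
    (hU : Uᵀ * U = 1) (v : n → ℝ) : (U *ᵥ v) ⬝ᵥ (U *ᵥ v) = v ⬝ᵥ v := by
  rw [dotProduct_mulVec, vecMul_mulVec, hU, vecMul_one]

/-- If a symmetric matrix is `δ`-close to the scalar `c` on the range of a linear map defined on a
space of dimension `card ι`, then at least `card ι` eigenvalues are `δ`-close to `c`. -/
lemma card_le_card_eigenvalues_near {n ι : Type*} [Fintype n] [DecidableEq n] [Fintype ι]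
    {Y : Matrix n n ℝ} (hY : Y.IsHermitian) (c : ℝ) {δ : ℝ} (hδ : 0 < δ)
    (L : (ι → ℝ) →ₗ[ℝ] (n → ℝ))
    (hL : ∀ x ≠ 0, (Y *ᵥ L x - c • L x) ⬝ᵥ (Y *ᵥ L x - c • L x) < δ ^ 2 * (L x ⬝ᵥ L x)) :
    Fintype.card ι ≤ #{i | |hY.eigenvalues i - c| < δ} := by
  classical
  set U : Matrix n n ℝ := (hY.eigenvectorUnitary : Matrix n n ℝ) with hUdef
  have hUt : star U = Uᵀ := by rw [star_eq_conjTranspose, conjTranspose_eq_transpose_of_trivial]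
  have h1 : Uᵀ * U = 1 := by
    rw [← hUt]; exact Unitary.coe_star_mul_self hY.eigenvectorUnitary
  have h2 : U * Uᵀ = 1 := by
    rw [← hUt]; exact Unitary.coe_mul_star_self hY.eigenvectorUnitary
  have hspec : Y = U * diagonal hY.eigenvalues * Uᵀ := by
    have h := hY.spectral_theorem
    rw [Unitary.conjStarAlgAut_apply] at h
    rw [← hUt]
    exact h
  set l := hY.eigenvalues with hl
  -- Φ keeps the eigenbasis coordinates of `L x` whose eigenvalue is near c. If they all vanish,
  -- every surviving coordinate is stretched by at least δ under Y - c, against `hL`; so Φ is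
  -- injective and dimensions compare.
  let Φ : (ι → ℝ) →ₗ[ℝ] ({i // |l i - c| < δ} → ℝ) :=
    (LinearMap.funLeft ℝ ℝ (fun i : {i // |l i - c| < δ} => (i : n))) ∘ₗ (mulVecLin Uᵀ) ∘ₗ L
  have hΦ : Function.Injective Φ := by
    rw [← LinearMap.ker_eq_bot, LinearMap.ker_eq_bot']
    intro x hx
    by_contra hne
    have key := hL x hne
    set y := Uᵀ *ᵥ L x with hy
    have hyU : L x = U *ᵥ y := by rw [hy, mulVec_mulVec, h2, one_mulVec]
    have hsm : ∀ i, |l i - c| < δ → y i = 0 := fun i hi => congrFun hx ⟨i, hi⟩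
    have e1 : Y *ᵥ L x - c • L x = U *ᵥ (fun i => (l i - c) * y i) := by
      have : (fun i => (l i - c) * y i) = diagonal l *ᵥ y - c • y := by
        ext i; simp [mulVec_diagonal, sub_mul]
      rw [this, mulVec_sub, mulVec_smul, ← hyU, mulVec_mulVec, hspec, ← mulVec_mulVec, ← hy]
    rw [e1, dotProduct_self_orthogonal h1, hyU, dotProduct_self_orthogonal h1] at key
    simp only [dotProduct, Finset.mul_sum] at key
    refine absurd key (not_lt.2 (Finset.sum_le_sum fun i _ => ?_))
    by_cases hi : |l i - c| < δ
    · simp [hsm i hi]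
    · have h3 : δ ^ 2 ≤ (l i - c) ^ 2 := by
        rw [← sq_abs (l i - c)]
        exact pow_le_pow_left₀ hδ.le (not_lt.1 hi) 2
      nlinarith [mul_self_nonneg (y i)]
  have := LinearMap.finrank_le_finrank_of_injective hΦ
  simpa [Module.finrank_fintype_fun_eq_card, Fintype.card_subtype] using this

/-- Only the characteristic polynomial of X enters, so the nonsymmetric products P⁻¹A can be treated
through a symmetric matrix similar to them. -/
lemma eigs_toComplex {n : Type*} [Fintype n] [DecidableEq n] {X Z : Matrix n n ℝ}
    (hZ : Z.IsHermitian) (h : X.charpoly = Z.charpoly) :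
    eigs (toComplex X) = univ.val.map fun i => (hZ.eigenvalues i : ℂ) := by
  have h1 : (toComplex X).charpoly = X.charpoly.map Complex.ofRealHom := by
    rw [← charpoly_map]; rfl
  rw [eigs, h1, h, hZ.charpoly_eq, Polynomial.map_prod]
  simp only [RCLike.ofReal_real_eq_id, id_eq, Polynomial.map_sub, Polynomial.map_X,
    Polynomial.map_C, Complex.ofRealHom_eq_coe]
  rw [Polynomial.roots_prod _ _ (Finset.prod_ne_zero_iff.2 fun i _ => Polynomial.X_sub_C_ne_zero _)]
  simp

open Classical in
lemma countP_eigs_add_card_le {n ι : Type*} [Fintype n] [DecidableEq n] [Fintype ι]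
    {X Z : Matrix n n ℝ} (hZ : Z.IsHermitian) (h : X.charpoly = Z.charpoly) (c : ℝ) {δ : ℝ}
    (hδ : 0 < δ) (L : (ι → ℝ) →ₗ[ℝ] (n → ℝ))
    (hL : ∀ x ≠ 0, (Z *ᵥ L x - c • L x) ⬝ᵥ (Z *ᵥ L x - c • L x) < δ ^ 2 * (L x ⬝ᵥ L x)) :
    (eigs (toComplex X)).countP (fun μ => δ ≤ ‖μ - (c : ℂ)‖) + Fintype.card ι
      ≤ Fintype.card n := by
  have h1 := card_le_card_eigenvalues_near hZ c hδ L hL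
  rw [eigs_toComplex hZ h, Multiset.countP_map]
  have h2 : (Multiset.filter (fun i => δ ≤ ‖((hZ.eigenvalues i : ℝ) : ℂ) - (c : ℂ)‖)
      (univ : Finset n).val).card = #{i | ¬ |hZ.eigenvalues i - c| < δ} := by
    rw [← Finset.filter_val, Finset.card_val]
    congr 1
    ext i
    simp only [Finset.mem_filter, Finset.mem_univ, true_and, not_lt]
    rw [← Complex.ofReal_sub, Complex.norm_real, Real.norm_eq_abs]
  rw [h2]
  have h3 := Finset.card_filter_add_card_filter_not (s := (univ : Finset n))
    (fun i => |hZ.eigenvalues i - c| < δ)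
  rw [Finset.card_univ] at h3
  omega

/-- Schur test on vectors supported in `S`. -/
lemma mulVec_dotProduct_self_le {n : Type*} [Fintype n] (Y : Matrix n n ℝ) (S : Finset n) {r : ℝ}
    (hrow : ∀ i, ∑ j ∈ S, |Y i j| ≤ r) (hcol : ∀ j ∈ S, ∑ i, |Y i j| ≤ r)
    (x : n → ℝ) (hx : ∀ i ∉ S, x i = 0) :
    (Y *ᵥ x) ⬝ᵥ (Y *ᵥ x) ≤ r ^ 2 * (x ⬝ᵥ x) := by
  have hmv : ∀ i, (Y *ᵥ x) i = ∑ j ∈ S, Y i j * x j := fun i => by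
    rw [mulVec, dotProduct]
    exact (Finset.sum_subset (subset_univ S) fun j _ hj => by rw [hx j hj, mul_zero]).symm
  have hxx : x ⬝ᵥ x = ∑ j ∈ S, x j ^ 2 := by
    rw [dotProduct]
    refine (Finset.sum_subset (subset_univ S) fun j _ hj => by simp [hx j hj]).symm.trans ?_
    exact Finset.sum_congr rfl fun j _ => (sq (x j)).symm
  have hstep : ∀ i, (Y *ᵥ x) i * (Y *ᵥ x) i ≤ r * ∑ j ∈ S, |Y i j| * x j ^ 2 := fun i => by
    have h0 : 0 ≤ ∑ j ∈ S, |Y i j| * x j ^ 2 :=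
      Finset.sum_nonneg fun j _ => mul_nonneg (abs_nonneg _) (sq_nonneg _)
    have hcs := Finset.sum_sq_le_sum_mul_sum_of_sq_le_mul S (r := fun j => Y i j * x j)
      (f := fun j => |Y i j|) (g := fun j => |Y i j| * x j ^ 2)
      (fun j _ => abs_nonneg _) (fun j _ => mul_nonneg (abs_nonneg _) (sq_nonneg _))
      (fun j _ => by rw [mul_pow, ← sq_abs (Y i j)]; exact le_of_eq (by ring))
    rw [hmv, ← sq]
    exact hcs.trans (mul_le_mul_of_nonneg_right (hrow i) h0)
  calc (Y *ᵥ x) ⬝ᵥ (Y *ᵥ x) ≤ ∑ i, r * ∑ j ∈ S, |Y i j| * x j ^ 2 :=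
        Finset.sum_le_sum fun i _ => hstep i
    _ = r * ∑ j ∈ S, (∑ i, |Y i j|) * x j ^ 2 := by
        rw [← Finset.mul_sum, Finset.sum_comm]
        simp only [Finset.sum_mul]
    _ ≤ r * ∑ j ∈ S, r * x j ^ 2 := by
        rcases isEmpty_or_nonempty n with hn | ⟨⟨i⟩⟩
        · simp [Finset.eq_empty_of_isEmpty S]
        · have hr : 0 ≤ r := (Finset.sum_nonneg fun j _ => abs_nonneg _).trans (hrow i)
          exact mul_le_mul_of_nonneg_left (Finset.sum_le_sum fun j hj =>
            mul_le_mul_of_nonneg_right (hcol j hj) (sq_nonneg _)) hr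
    _ = r ^ 2 * (x ⬝ᵥ x) := by rw [hxx, ← Finset.mul_sum]; ring

/-- Extension by zero of a vector indexed by `S`. -/
def extendByZero {n : Type*} [DecidableEq n] (S : Finset n) : (S → ℝ) →ₗ[ℝ] (n → ℝ) where
  toFun x i := if h : i ∈ S then x ⟨i, h⟩ else 0
  map_add' x y := by ext i; by_cases h : i ∈ S <;> simp [h]
  map_smul' a x := by ext i; by_cases h : i ∈ S <;> simp [h]

lemma extendByZero_of_notMem {n : Type*} [DecidableEq n] (S : Finset n) (x : S → ℝ) {i : n}
    (hi : i ∉ S) : extendByZero S x i = 0 := by simp [extendByZero, hi]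

lemma extendByZero_ne_zero {n : Type*} [DecidableEq n] (S : Finset n) {x : S → ℝ} (hx : x ≠ 0) :
    extendByZero S x ≠ 0 := by
  intro h
  refine hx (funext fun i => ?_)
  simpa [extendByZero] using congrFun h (i : n)

lemma dotProduct_self_pos {n : Type*} [Fintype n] {x : n → ℝ} (hx : x ≠ 0) : 0 < x ⬝ᵥ x := by
  have h0 : 0 ≤ x ⬝ᵥ x := Finset.sum_nonneg fun i _ => mul_self_nonneg _
  exact lt_of_le_of_ne h0 fun h => hx (dotProduct_self_eq_zero.1 h.symm)

/-! ### Negligible sequences and weak clustering -/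

/-- Matrices that become small (in row and column sums) after the removal of few columns. -/
def Negligible {I : ℕ → Type*} [∀ k, Fintype (I k)] [∀ k, DecidableEq (I k)]
    (Y : ∀ k, Matrix (I k) (I k) ℝ) : Prop :=
  ∀ η : ℝ, 0 < η → ∀ᶠ k in atTop, ∃ S : Finset (I k),
    (#Sᶜ : ℝ) ≤ η * Fintype.card (I k) ∧
      (∀ i, ∑ j ∈ S, |Y k i j| ≤ η) ∧ (∀ j ∈ S, ∑ i, |Y k i j| ≤ η)

/-- Weak clustering from a bound on the number of outlying eigenvalues. -/
lemma weaklyClusteredAt_of_forall {I : ℕ → Type*} [∀ k, Fintype (I k)] [∀ k, DecidableEq (I k)]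
    {X : ∀ k, Matrix (I k) (I k) ℂ} {z : ℂ}
    (h : ∀ η δ : ℝ, 0 < η → 0 < δ → ∀ᶠ k in atTop, ∃ m : ℕ, (m : ℝ) ≤ η * Fintype.card (I k) ∧
      ∀ p : ℂ → Prop, ∀ _ : DecidablePred p, (∀ μ, p μ ↔ δ ≤ ‖μ - z‖) →
        (eigs (X k)).countP p ≤ m) :
    WeaklyClusteredAt X z := by
  classical
  intro δ hδ
  rw [Metric.tendsto_nhds]
  intro ε hε
  filter_upwards [h (ε / 2) δ (half_pos hε) hδ] with k ⟨m, hm, hc⟩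
  have hc' := hc (fun μ => δ ≤ ‖μ - z‖) (fun _ => Classical.propDecidable _) fun _ => Iff.rfl
  rw [Real.dist_eq, sub_zero, abs_of_nonneg (by positivity)]
  rcases Nat.eq_zero_or_pos (Fintype.card (I k)) with h0 | h0
  · simp [h0, hε]
  · have h0' : (0 : ℝ) < Fintype.card (I k) := by exact_mod_cast h0
    rw [div_lt_iff₀ h0']
    have : ((eigs (X k)).countP (fun μ => δ ≤ ‖μ - z‖) : ℝ) ≤ m := by exact_mod_cast hc'
    nlinarith

/-- Abstract clustering criterion: `X k` has the characteristic polynomial of `c + K k`, where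
`K k` is the transform of a negligible matrix by a congruence that does not increase norms. -/
lemma weaklyClusteredAt_of_negligible {I : ℕ → Type*} [∀ k, Fintype (I k)]
    [∀ k, DecidableEq (I k)] {X Y : ∀ k, Matrix (I k) (I k) ℝ} (hY : Negligible Y) (c : ℝ)
    (h : ∀ᶠ k in atTop, ∃ Z : Matrix (I k) (I k) ℝ, ∃ B : Matrix (I k) (I k) ℝ,
      Z.IsHermitian ∧ (X k).charpoly = Z.charpoly ∧ (∀ x, x ⬝ᵥ x ≤ (B *ᵥ x) ⬝ᵥ (B *ᵥ x)) ∧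
      ∀ x, (Z *ᵥ (B *ᵥ x) - c • (B *ᵥ x)) ⬝ᵥ (Z *ᵥ (B *ᵥ x) - c • (B *ᵥ x))
        ≤ (Y k *ᵥ x) ⬝ᵥ (Y k *ᵥ x)) :
    WeaklyClusteredAt (fun k => toComplex (X k)) (c : ℂ) := by
  classical
  refine weaklyClusteredAt_of_forall fun η δ hη hδ => ?_
  filter_upwards [hY (min η (δ / 2)) (lt_min hη (half_pos hδ)), h] with k ⟨S, hS, hrow, hcol⟩
    ⟨Z, B, hZ, hchar, hB, hZB⟩
  refine ⟨#Sᶜ, hS.trans (mul_le_mul_of_nonneg_right (min_le_left _ _) (Nat.cast_nonneg _)), ?_⟩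
  intro p hp hiff
  -- The test space is the image under B of the vectors supported in S. There the Schur test gives
  -- (δ/2)²‖v‖² < δ²‖v‖² ≤ δ²‖Bv‖², so at most `#Sᶜ` eigenvalues are outliers; halving δ secures
  -- strictness.
  have hcount := countP_eigs_add_card_le hZ hchar c hδ
    ((mulVecLin B) ∘ₗ (extendByZero S)) (fun x hx => ?_)
  · rw [Fintype.card_coe, ← Finset.card_add_card_compl S] at hcount
    have : (eigs (toComplex (X k))).countP p
        = (eigs (toComplex (X k))).countP (fun μ => δ ≤ ‖μ - (c : ℂ)‖) :=
      Multiset.countP_congr rfl fun μ _ => by rw [hiff]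
    omega
  · simp only [LinearMap.comp_apply, mulVecLin_apply]
    set v := extendByZero S x
    have hv : 0 < v ⬝ᵥ v := dotProduct_self_pos (extendByZero_ne_zero S hx)
    have h1 := mulVec_dotProduct_self_le (Y k) S (r := δ / 2)
      (fun i => (hrow i).trans (min_le_right _ _)) (fun j hj => (hcol j hj).trans (min_le_right _ _))
      v (fun i hi => extendByZero_of_notMem S x hi)
    have h2 := hB v
    have h3 := hZB v
    have h4 : δ ^ 2 * (v ⬝ᵥ v) ≤ δ ^ 2 * ((B *ᵥ v) ⬝ᵥ (B *ᵥ v)) :=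
      mul_le_mul_of_nonneg_left h2 (sq_nonneg _)
    have h5 : 0 < δ ^ 2 * (v ⬝ᵥ v) := by positivity
    nlinarith

lemma Negligible.weaklyClusteredAt_zero {I : ℕ → Type*} [∀ k, Fintype (I k)]
    [∀ k, DecidableEq (I k)] {Y : ∀ k, Matrix (I k) (I k) ℝ} (hY : Negligible Y)
    (hsymm : ∀ k, (Y k).IsHermitian) : WeaklyClusteredAt (fun k => toComplex (Y k)) 0 := by
  have := weaklyClusteredAt_of_negligible (X := Y) hY 0 (Eventually.of_forall fun k =>
    ⟨Y k, 1, hsymm k, rfl, fun x => by simp, fun x => by simp⟩)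
  simpa using this

/-- If `P ≥ 1` and `A - P` is negligible, the preconditioned matrices cluster at `1`. -/
lemma weaklyClusteredAt_inv_mul {I : ℕ → Type*} [∀ k, Fintype (I k)]
    [∀ k, DecidableEq (I k)] {A P : ∀ k, Matrix (I k) (I k) ℝ}
    (hY : Negligible fun k => A k - P k) (hA : ∀ k, (A k).IsHermitian)
    (hP : ∀ᶠ k in atTop, (P k - 1).PosSemidef) :
    WeaklyClusteredAt (fun k => toComplex ((P k)⁻¹ * A k)) 1 := by
  have := weaklyClusteredAt_of_negligible (X := fun k => (P k)⁻¹ * A k) hY 1 ?_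
  · simpa using this
  filter_upwards [hP] with k hk
  have hPD : (P k).PosDef := by
    have := PosDef.one.add_posSemidef hk
    rwa [add_sub_cancel] at this
  obtain ⟨B, hB⟩ : ∃ B : Matrix (I k) (I k) ℝ, P k = Bᵀ * B := by
    open scoped MatrixOrder in
    obtain ⟨B, hB⟩ := CStarAlgebra.nonneg_iff_eq_star_mul_self.mp hPD.posSemidef.nonneg
    exact ⟨B, by rw [hB, star_eq_conjTranspose, conjTranspose_eq_transpose_of_trivial]⟩
  have hBu : IsUnit B.det := by
    have h1 := (Matrix.isUnit_iff_isUnit_det _).1 hPD.isUnit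
    rw [hB, det_mul] at h1
    exact isUnit_of_mul_isUnit_right h1
  have hBtu : IsUnit Bᵀ.det := by rwa [det_transpose]
  have hexp : ∀ x, x ⬝ᵥ x ≤ (B *ᵥ x) ⬝ᵥ (B *ᵥ x) := fun x => by
    have h1 := hk.dotProduct_mulVec_nonneg x
    rw [star_trivial, sub_mulVec, one_mulVec, dotProduct_sub, hB, ← mulVec_mulVec,
      dotProduct_mulVec, vecMul_transpose] at h1
    linarith
  -- Moving B⁻¹ to the front cyclically turns this symmetric matrix into P⁻¹A without changing the
  -- characteristic polynomial.
  refine ⟨Bᵀ⁻¹ * A k * B⁻¹, B, ?_, ?_, hexp, fun x => ?_⟩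
  · have hA' : (A k)ᵀ = A k := by
      rw [← conjTranspose_eq_transpose_of_trivial]; exact hA k
    rw [IsHermitian, conjTranspose_eq_transpose_of_trivial, transpose_mul, transpose_mul, hA',
      transpose_nonsing_inv, transpose_nonsing_inv, transpose_transpose, Matrix.mul_assoc]
  · rw [charpoly_mul_comm _ B⁻¹, hB, Matrix.mul_inv_rev, Matrix.mul_assoc]
  · have e : (Bᵀ⁻¹ * A k * B⁻¹) *ᵥ (B *ᵥ x) - (1 : ℝ) • (B *ᵥ x)
        = Bᵀ⁻¹ *ᵥ ((A k - P k) *ᵥ x) := by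
      rw [one_smul, mulVec_mulVec, Matrix.mul_assoc, Matrix.nonsing_inv_mul _ hBu, Matrix.mul_one,
        sub_mulVec, mulVec_sub, mulVec_mulVec, mulVec_mulVec, hB, ← Matrix.mul_assoc,
        Matrix.nonsing_inv_mul _ hBtu, Matrix.one_mul]
    rw [e]
    set y := (A k - P k) *ᵥ x
    set z := Bᵀ⁻¹ *ᵥ y with hz
    set w := B⁻¹ *ᵥ z with hw
    have hBw : B *ᵥ w = z := by
      rw [hw, mulVec_mulVec, Matrix.mul_nonsing_inv _ hBu, one_mulVec]
    have h1 : w ⬝ᵥ w ≤ z ⬝ᵥ z := by simpa only [hBw] using hexp w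
    have h2 : z ⬝ᵥ z = w ⬝ᵥ y :=
      calc z ⬝ᵥ z = z ⬝ᵥ (Bᵀ⁻¹ *ᵥ y) := rfl
        _ = w ⬝ᵥ y := by rw [dotProduct_mulVec, ← transpose_nonsing_inv, vecMul_transpose]
    -- Combining: 2‖z‖² = 2⟨w, y⟩ ≤ ‖w‖² + ‖y‖² ≤ ‖z‖² + ‖y‖², so ‖B⁻ᵀy‖ ≤ ‖y‖.
    have h3 : 0 ≤ (w - y) ⬝ᵥ (w - y) := Finset.sum_nonneg fun i _ => mul_self_nonneg _
    rw [sub_dotProduct, dotProduct_sub, dotProduct_sub, dotProduct_comm y w] at h3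
    linarith

lemma WeaklyClusteredAt.congr {I : ℕ → Type*} [∀ k, Fintype (I k)] [∀ k, DecidableEq (I k)]
    {X X' : ∀ k, Matrix (I k) (I k) ℂ} {z : ℂ} (h : WeaklyClusteredAt X z)
    (he : ∀ᶠ k in atTop, X k = X' k) : WeaklyClusteredAt X' z := fun δ hδ =>
  (h δ hδ).congr' (he.mono fun k hk => by simp only [hk])

/-! ### From clustering at 0 to the zero distribution -/

lemma volume_real_cube_ne_zero (d : ℕ) : volume.real (cube d) ≠ 0 := by
  have h : (0 : ℝ) < Real.pi - -Real.pi := by linarith [Real.pi_pos]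
  rw [cube, measureReal_def, Real.volume_Icc_pi]
  refine (ENNReal.toReal_pos ?_ ?_).ne'
  · exact Finset.prod_ne_zero_iff.2 fun i _ => by simpa using h
  · exact ENNReal.prod_ne_top fun i _ => ENNReal.ofReal_ne_top

/-- Weak clustering at `0` of nonempty matrices is the distribution relation with symbol `0`. -/
lemma WeaklyClusteredAt.zeroDistributed {I : ℕ → Type*} [∀ k, Fintype (I k)]
    [∀ k, DecidableEq (I k)] [∀ k, Nonempty (I k)] {X : ∀ k, Matrix (I k) (I k) ℂ}
    (h : WeaklyClusteredAt X 0) (d : ℕ) : ZeroDistributed d X := by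
  classical
  intro F hF hFc
  have hlim : (((volume.real (cube d))⁻¹ : ℝ) : ℂ) * ∫ _ in cube d, F 0 = F 0 := by
    rw [setIntegral_const, Complex.real_smul, ← mul_assoc, ← Complex.ofReal_mul,
      inv_mul_cancel₀ (volume_real_cube_ne_zero d), Complex.ofReal_one, one_mul]
  simp only [hlim]
  obtain ⟨C, hC⟩ := hFc.exists_bound_of_continuous hF
  have hC0 : 0 ≤ C := (norm_nonneg _).trans (hC 0)
  rw [Metric.tendsto_nhds]
  intro ε hε
  obtain ⟨δ, hδ, hFδ⟩ := Metric.continuousAt_iff.1 hF.continuousAt (ε / 2) (half_pos hε)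
  -- Eigenvalues inside the disk cost at most ε/2 on average, those outside at most 2C each; a
  -- proportion below ε/(4(C+1)) keeps the latter total under ε/2.
  have hev := (h δ hδ).eventually (gt_mem_nhds (show (0 : ℝ) < ε / (4 * (C + 1)) by positivity))
  filter_upwards [hev] with k hk
  set s := eigs (X k) with hs
  have hcard : Multiset.card s = Fintype.card (I k) := by
    rw [hs, eigs, Polynomial.splits_iff_card_roots.1 (IsAlgClosed.splits _),
      charpoly_natDegree_eq_dim]
  have hpos : (0 : ℝ) < Fintype.card (I k) := by exact_mod_cast Fintype.card_pos
  have hbound : ∀ t : Multiset ℂ, ‖(t.map F).sum - (Multiset.card t : ℂ) * F 0‖ ≤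
      ε / 2 * Multiset.card t + 2 * C * (t.countP fun μ => δ ≤ ‖μ - 0‖) := by
    intro t
    induction t using Multiset.induction_on with
    | empty => simp
    | cons a t ih =>
      rw [Multiset.map_cons, Multiset.sum_cons, Multiset.card_cons, Multiset.countP_cons]
      have e : F a + (t.map F).sum - ((Multiset.card t + 1 : ℕ) : ℂ) * F 0
          = (F a - F 0) + ((t.map F).sum - (Multiset.card t : ℂ) * F 0) := by
        push_cast; ring
      rw [e]
      refine (norm_add_le _ _).trans ?_
      have ha : ‖F a - F 0‖ ≤ ε / 2 + 2 * C * (if δ ≤ ‖a - 0‖ then 1 else 0 : ℕ) := by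
        split_ifs with hd
        · have := (norm_sub_le (F a) (F 0)).trans (add_le_add (hC a) (hC 0))
          push_cast
          linarith
        · have := hFδ (x := a) (by rw [dist_eq_norm]; exact not_le.1 hd)
          rw [dist_eq_norm] at this
          simpa using this.le
      push_cast at ha ih ⊢
      linarith
  have hb := hbound s
  have e : (Fintype.card (I k) : ℂ)⁻¹ * (s.map F).sum - F 0
      = (Fintype.card (I k) : ℂ)⁻¹ * ((s.map F).sum - (Multiset.card s : ℂ) * F 0) := by
    have : (Fintype.card (I k) : ℂ) ≠ 0 := by exact_mod_cast Fintype.card_ne_zero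
    rw [hcard]; field_simp
  rw [dist_eq_norm, e, norm_mul, norm_inv, Complex.norm_natCast, inv_mul_lt_iff₀ hpos]
  rw [hcard] at hb ⊢
  have hk' : ((s.countP fun μ => δ ≤ ‖μ - 0‖ : ℕ) : ℝ)
      < ε / (4 * (C + 1)) * Fintype.card (I k) := by
    rw [div_lt_iff₀ hpos] at hk
    exact hk
  have h5 : 2 * C * (ε / (4 * (C + 1))) < ε / 2 := by
    have : ε / 2 = 2 * (C + 1) * (ε / (4 * (C + 1))) := by field_simp; norm_num
    rw [this]
    have : 0 < ε / (4 * (C + 1)) := by positivity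
    nlinarith
  have h6 : 2 * C * ((s.countP fun μ => δ ≤ ‖μ - 0‖ : ℕ) : ℝ)
      ≤ 2 * C * (ε / (4 * (C + 1)) * Fintype.card (I k)) :=
    mul_le_mul_of_nonneg_left hk'.le (by positivity)
  nlinarith

/-! ### Kronecker sums -/

lemma sum_abs_kronecker_le {m n : Type*} [DecidableEq m] [DecidableEq n] (Y₁ : Matrix m m ℝ)
    (Y₂ : Matrix n n ℝ) (S₁ : Finset m) (S₂ : Finset n) (i : m × n) :
    ∑ j ∈ S₁ ×ˢ S₂, |(Y₁ ⊗ₖ (1 : Matrix n n ℝ) + (1 : Matrix m m ℝ) ⊗ₖ Y₂) i j|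
      ≤ ∑ j ∈ S₁, |Y₁ i.1 j| + ∑ j ∈ S₂, |Y₂ i.2 j| := by
  have h1 : ∑ j ∈ S₁ ×ˢ S₂, |Y₁ i.1 j.1| * (1 : Matrix n n ℝ) i.2 j.2
      ≤ ∑ j ∈ S₁, |Y₁ i.1 j| := by
    rw [Finset.sum_product]
    refine Finset.sum_le_sum fun a _ => ?_
    simp only [one_apply, mul_ite, mul_one, mul_zero, Finset.sum_ite_eq]
    split_ifs <;> simp
  have h2 : ∑ j ∈ S₁ ×ˢ S₂, (1 : Matrix m m ℝ) i.1 j.1 * |Y₂ i.2 j.2|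
      ≤ ∑ j ∈ S₂, |Y₂ i.2 j| := by
    rw [Finset.sum_product_right]
    refine Finset.sum_le_sum fun a _ => ?_
    simp only [one_apply, ite_mul, one_mul, zero_mul, Finset.sum_ite_eq]
    split_ifs <;> simp
  refine le_trans ?_ (add_le_add h1 h2)
  rw [← Finset.sum_add_distrib]
  refine Finset.sum_le_sum fun j _ => ?_
  rw [Matrix.add_apply, kroneckerMap_apply, kroneckerMap_apply]
  refine (abs_add_le _ _).trans (le_of_eq ?_)
  have e1 : |(1 : Matrix n n ℝ) i.2 j.2| = (1 : Matrix n n ℝ) i.2 j.2 := by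
    rw [one_apply]; split_ifs <;> simp
  have e2 : |(1 : Matrix m m ℝ) i.1 j.1| = (1 : Matrix m m ℝ) i.1 j.1 := by
    rw [one_apply]; split_ifs <;> simp
  rw [abs_mul, abs_mul, e1, e2]

/-- The Kronecker sum of negligible sequences is negligible. -/
lemma Negligible.kronecker_sum {I J : ℕ → Type*} [∀ k, Fintype (I k)] [∀ k, DecidableEq (I k)]
    [∀ k, Fintype (J k)] [∀ k, DecidableEq (J k)] {Y₁ : ∀ k, Matrix (I k) (I k) ℝ}
    {Y₂ : ∀ k, Matrix (J k) (J k) ℝ} (h₁ : Negligible Y₁) (h₂ : Negligible Y₂) :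
    Negligible fun k => Y₁ k ⊗ₖ (1 : Matrix (J k) (J k) ℝ) + (1 : Matrix (I k) (I k) ℝ) ⊗ₖ Y₂ k := by
  intro η hη
  filter_upwards [h₁ _ (half_pos hη), h₂ _ (half_pos hη)] with k ⟨S₁, hc₁, hr₁, hl₁⟩
    ⟨S₂, hc₂, hr₂, hl₂⟩
  refine ⟨S₁ ×ˢ S₂, ?_, fun i => ?_, fun j hj => ?_⟩
  · have hsub : (S₁ ×ˢ S₂)ᶜ ⊆ S₁ᶜ ×ˢ univ ∪ univ ×ˢ S₂ᶜ := fun x hx => by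
      simp only [mem_compl, mem_product, mem_union, mem_univ, and_true, true_and] at hx ⊢
      tauto
    have h := (card_le_card hsub).trans (card_union_le _ _)
    rw [card_product, card_product, card_univ, card_univ] at h
    have h' : (#(S₁ ×ˢ S₂)ᶜ : ℝ) ≤ #S₁ᶜ * Fintype.card (J k) + Fintype.card (I k) * #S₂ᶜ := by
      exact_mod_cast h
    rw [Fintype.card_prod, Nat.cast_mul]
    have e1 := mul_le_mul_of_nonneg_right hc₁ (Nat.cast_nonneg (α := ℝ) (Fintype.card (J k)))
    have e2 := mul_le_mul_of_nonneg_left hc₂ (Nat.cast_nonneg (α := ℝ) (Fintype.card (I k)))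
    linarith
  · refine (sum_abs_kronecker_le _ _ S₁ S₂ i).trans ?_
    linarith [hr₁ i.1, hr₂ i.2]
  · rw [mem_product] at hj
    -- Column sums are row sums of the transposed Kronecker sum, so the same row estimate applies.
    have e : ∀ i, (Y₁ k ⊗ₖ (1 : Matrix (J k) (J k) ℝ) + (1 : Matrix (I k) (I k) ℝ) ⊗ₖ Y₂ k) i j
        = ((Y₁ k)ᵀ ⊗ₖ (1 : Matrix (J k) (J k) ℝ)
          + (1 : Matrix (I k) (I k) ℝ) ⊗ₖ (Y₂ k)ᵀ) j i := fun i => by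
      simp [one_apply, eq_comm]
    simp only [e]
    rw [← univ_product_univ]
    refine (sum_abs_kronecker_le _ _ univ univ j).trans ?_
    have := hl₁ j.1 hj.1
    have := hl₂ j.2 hj.2
    simp only [transpose_apply]
    linarith

/-! ### Grünwald weights -/

/-- Partial sums `g 0 + ⋯ + g m` of the Grünwald coefficients. -/
noncomputable def grunwaldSum (α : ℝ) (m : ℕ) : ℝ := ∑ k ∈ range (m + 1), grunwald α k

/-- This ties each coefficient to the preceding partial sum, so the partial sums obey a one-term
product recursion from which both signs and decay are read off. -/
lemma grunwald_succ_eq (α : ℝ) (m : ℕ) :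
    grunwald α (m + 1) = -(α / ((m : ℝ) + 1)) * grunwaldSum α m := by
  induction m with
  | zero => simp [grunwald, grunwaldSum]
  | succ m ih =>
    have h1 : grunwaldSum α (m + 1) = grunwaldSum α m + grunwald α (m + 1) := by
      rw [grunwaldSum, sum_range_succ]; rfl
    have h2 : grunwald α (m + 1 + 1)
        = (1 - (α + 1) / (((m + 1 : ℕ) : ℝ) + 1)) * grunwald α (m + 1) := rfl
    rw [h2, h1, ih]
    push_cast
    field_simp
    ring

lemma grunwaldSum_succ (α : ℝ) (m : ℕ) :
    grunwaldSum α (m + 1) = (1 - α / ((m : ℝ) + 1)) * grunwaldSum α m := by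
  have h1 : grunwaldSum α (m + 1) = grunwaldSum α m + grunwald α (m + 1) := by
    rw [grunwaldSum, sum_range_succ]; rfl
  rw [h1, grunwald_succ_eq]; ring


lemma one_sub_div_nonneg {α : ℝ} (h2 : α < 2) (m : ℕ) : 0 ≤ 1 - α / (((m + 1 : ℕ) : ℝ) + 1) := by
  rw [sub_nonneg, div_le_one (by positivity)]
  push_cast
  linarith [Nat.cast_nonneg (α := ℝ) m]

/-- The first factor of the product recursion is 1 - α < 0 and all later ones are nonnegative. The
index starts at 1 because the zeroth partial sum is 1. -/
lemma grunwaldSum_nonpos {α : ℝ} (h1 : 1 < α) (h2 : α < 2) (m : ℕ) :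
    grunwaldSum α (m + 1) ≤ 0 := by
  induction m with
  | zero => rw [grunwaldSum_succ]; simp [grunwaldSum, grunwald]; linarith
  | succ m ih =>
    rw [grunwaldSum_succ]
    exact mul_nonpos_of_nonneg_of_nonpos (one_sub_div_nonneg h2 m) ih

lemma grunwald_nonneg {α : ℝ} (h1 : 1 < α) (h2 : α < 2) (m : ℕ) : 0 ≤ grunwald α (m + 2) := by
  rw [grunwald_succ_eq]
  refine mul_nonneg_of_nonpos_of_nonpos ?_ (grunwaldSum_nonpos h1 h2 m)
  have : 0 ≤ α / (((m + 1 : ℕ) : ℝ) + 1) := by positivity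
  linarith

lemma grunwaldSum_le_succ {α : ℝ} (h1 : 1 < α) (h2 : α < 2) (m : ℕ) :
    grunwaldSum α (m + 1) ≤ grunwaldSum α (m + 2) := by
  have e : grunwaldSum α (m + 2) = grunwaldSum α (m + 1) + grunwald α (m + 2) := by
    rw [grunwaldSum, sum_range_succ]; rfl
  linarith [grunwald_nonneg h1 h2 m]

/-- The partial sums decay like `m ^ (-α)`. -/
lemma neg_grunwaldSum_le {α : ℝ} (h1 : 1 < α) (h2 : α < 2) (m : ℕ) :
    -grunwaldSum α (m + 1) ≤ ((m : ℝ) + 1) ^ (-α) := by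
  induction m with
  | zero => rw [grunwaldSum_succ]; simp [grunwaldSum, grunwald]; linarith
  | succ m ih =>
    -- Bernoulli's inequality for (1 - 1/(m+2))^α; the resulting ratios telescope to (m+2)^{-α}.
    have hb : 1 - α / (((m + 1 : ℕ) : ℝ) + 1) ≤ (((m : ℝ) + 1) / ((m : ℝ) + 2)) ^ α := by
      have hs : (-1 : ℝ) ≤ -1 / ((m : ℝ) + 2) := by
        rw [le_div_iff₀ (by positivity)]; linarith [Nat.cast_nonneg (α := ℝ) m]
      have := one_add_mul_self_le_rpow_one_add hs h1.le
      have e1 : 1 + α * (-1 / ((m : ℝ) + 2)) = 1 - α / (((m + 1 : ℕ) : ℝ) + 1) := by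
        push_cast; field_simp; ring
      have e2 : 1 + -1 / ((m : ℝ) + 2) = ((m : ℝ) + 1) / ((m : ℝ) + 2) := by
        field_simp; ring
      rwa [e1, e2] at this
    have hm1 : (0 : ℝ) < (m : ℝ) + 1 := by positivity
    have hm2 : (0 : ℝ) < (m : ℝ) + 2 := by positivity
    calc -grunwaldSum α (m + 1 + 1)
        = (1 - α / (((m + 1 : ℕ) : ℝ) + 1)) * -grunwaldSum α (m + 1) := by
          rw [grunwaldSum_succ]; ring
      _ ≤ (((m : ℝ) + 1) / ((m : ℝ) + 2)) ^ α * ((m : ℝ) + 1) ^ (-α) :=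
          mul_le_mul hb ih (neg_nonneg.2 (grunwaldSum_nonpos h1 h2 m)) (by positivity)
      _ = (((m + 1 : ℕ) : ℝ) + 1) ^ (-α) := by
          rw [Real.div_rpow hm1.le hm2.le, Real.rpow_neg hm1.le, Real.rpow_neg (by positivity)]
          have : ((m : ℝ) + 1) ^ α ≠ 0 := (Real.rpow_pos_of_pos hm1 _).ne'
          push_cast
          rw [show (m : ℝ) + 1 + 1 = m + 2 by ring]
          field_simp

lemma sum_weight_oneZero (α : ℝ) (n : ℕ) : ∑ k ∈ range (n + 2), weight .oneZero α k
    = α / 2 * grunwaldSum α (n + 1) + (2 - α) / 2 * grunwaldSum α n := by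
  rw [sum_range_succ']
  simp only [weight, sum_add_distrib, ← mul_sum]
  rw [grunwaldSum, grunwaldSum, sum_range_succ' _ (n + 1)]
  ring

lemma sum_weight_oneNegOne (α : ℝ) (n : ℕ) : ∑ k ∈ range (n + 3), weight .oneNegOne α k
    = (α + 2) / 4 * grunwaldSum α (n + 2) + (2 - α) / 4 * grunwaldSum α n := by
  rw [sum_range_succ', sum_range_succ']
  simp only [weight, sum_add_distrib, ← mul_sum]
  rw [grunwaldSum, grunwaldSum, sum_range_succ' _ (n + 2), sum_range_succ' _ (n + 1)]
  ring

lemma sum_weight_nonpos (σ : Shift) {α : ℝ} (h1 : 1 < α) (h2 : α < 2) (n : ℕ) :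
    ∑ k ∈ range (n + 4), weight σ α k ≤ 0 := by
  have a1 := grunwaldSum_nonpos h1 h2 n
  have a2 := grunwaldSum_nonpos h1 h2 (n + 1)
  have a3 := grunwaldSum_nonpos h1 h2 (n + 2)
  cases σ
  · rw [sum_weight_oneZero α (n + 2)]
    nlinarith
  · rw [sum_weight_oneNegOne α (n + 1)]
    nlinarith

/-- The partial sums of the weights are convex combinations of Grünwald partial sums. These increase
from index 1 on, so the earliest one that can occur, of index n+1, gives the bound. -/
lemma neg_sum_weight_le (σ : Shift) {α : ℝ} (h1 : 1 < α) (h2 : α < 2) (n : ℕ) :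
    -∑ k ∈ range (n + 4), weight σ α k ≤ ((n : ℝ) + 1) ^ (-α) := by
  have a1 := grunwaldSum_le_succ h1 h2 n
  have a2 := grunwaldSum_le_succ h1 h2 (n + 1)
  refine le_trans ?_ (neg_grunwaldSum_le h1 h2 n)
  cases σ
  · rw [sum_weight_oneZero α (n + 2)]
    have b1 := mul_le_mul_of_nonneg_left (a1.trans a2) (show 0 ≤ α / 2 by linarith)
    have b2 := mul_le_mul_of_nonneg_left a1 (show 0 ≤ (2 - α) / 2 by linarith)
    linarith
  · rw [sum_weight_oneNegOne α (n + 1)]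
    have b1 := mul_le_mul_of_nonneg_left (a1.trans a2) (show 0 ≤ (α + 2) / 4 by linarith)
    linarith

/-! ### Coefficients of the symmetric Toeplitz matrix -/

/-- The entries of the first column of `symG`. -/
noncomputable def symCoeff (σ : Shift) (α : ℝ) : ℕ → ℝ
  | 0 => 2 * weight σ α 1
  | 1 => weight σ α 0 + weight σ α 2
  | k + 2 => weight σ α (k + 3)

/-- With truncated subtraction one of the two differences is zero, so the index is |i - j|. -/
lemma symG_apply (σ : Shift) (α : ℝ) {M : ℕ} (i j : Fin M) :
    symG σ α M i j = symCoeff σ α ((i : ℕ) - j + (j - i)) := by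
  have key : ∀ i j : ℕ, i < j → (if j ≤ i + 1 then weight σ α (i + 1 - j) else 0)
      + weight σ α (j + 1 - i) = symCoeff σ α (j - i) := by
    intro i j hij
    obtain ⟨d, rfl⟩ : ∃ d, j = i + 1 + d := ⟨j - (i + 1), by omega⟩
    rcases d with _ | d
    · simp [symCoeff, show i + 1 + 1 - i = 2 by omega]
    · rw [if_neg (by omega), zero_add, show i + 1 + (d + 1) - i = d + 2 by omega,
        show i + 1 + (d + 1) + 1 - i = d + 3 by omega, symCoeff]
  simp only [symG, calG, Matrix.add_apply, transpose_apply, of_apply]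
  rcases lt_trichotomy (i : ℕ) j with h | h | h
  · rw [if_pos (show (i : ℕ) ≤ j + 1 by omega), key _ _ h]
    congr 1; omega
  · simp [h, symCoeff, two_mul]
  · rw [if_pos (show (j : ℕ) ≤ i + 1 by omega), add_comm, key _ _ h]
    congr 1; omega

lemma symCoeff_nonneg (σ : Shift) {α : ℝ} (h1 : 1 < α) (h2 : α < 2) (k : ℕ) :
    0 ≤ symCoeff σ α (k + 3) := by
  have a1 := grunwald_nonneg h1 h2 k
  have a2 := grunwald_nonneg h1 h2 (k + 1)
  have a3 := grunwald_nonneg h1 h2 (k + 2)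
  have b : 0 < 2 - α := by linarith
  cases σ <;> simp only [symCoeff, weight] <;> positivity

lemma symCoeff_one_nonneg (σ : Shift) {α : ℝ} (h1 : 1 < α) (h2 : α < 2) :
    0 ≤ symCoeff σ α 1 := by
  cases σ <;> simp only [symCoeff, weight, grunwald] <;> norm_num <;>
    nlinarith [mul_pos (sub_pos.2 h1) (sub_pos.2 h2),
      mul_pos (show 0 < α by linarith) (sub_pos.2 h1),
      mul_pos (mul_pos (show 0 < α by linarith) (sub_pos.2 h1)) (show 0 < α + 2 by linarith)]

/-- For the pair (1, -1) the coefficient c_2 is negative. This inequality lets c_1 absorb it,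
through D_2 ≤ 4 D_1 for squared differences of a cyclic sequence. -/
lemma symCoeff_one_add_nonneg (σ : Shift) {α : ℝ} (h1 : 1 < α) (h2 : α < 2) :
    0 ≤ symCoeff σ α 1 + 4 * symCoeff σ α 2 := by
  cases σ
  · have h := symCoeff_one_nonneg .oneZero h1 h2
    have a1 := grunwald_nonneg h1 h2 0
    have a2 := grunwald_nonneg h1 h2 1
    have b : 0 < 2 - α := by linarith
    have : 0 ≤ symCoeff .oneZero α 2 := by
      simp only [symCoeff, weight]; positivity
    linarith
  · have e : symCoeff .oneNegOne α 1 + 4 * symCoeff .oneNegOne α 2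
        = (α - 1) * (-4 * α ^ 3 + 3 * α ^ 2 + 46 * α - 24) / 24 := by
      simp only [symCoeff, weight, grunwald]; norm_num; ring
    rw [e]
    -- The cubic equals 4α(2-α)(α+2) + 3α² + 30α - 24.
    have h3 : 0 ≤ -4 * α ^ 3 + 3 * α ^ 2 + 46 * α - 24 := by
      nlinarith [mul_pos (show 0 < α by linarith) (sub_pos.2 h2),
        mul_pos (mul_pos (show 0 < α by linarith) (sub_pos.2 h2)) (show 0 < α + 2 by linarith)]
    have h4 : 0 < α - 1 := by linarith
    positivity

lemma sum_symCoeff (σ : Shift) (α : ℝ) (n : ℕ) :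
    symCoeff σ α 0 + 2 * ∑ k ∈ Ico 1 (n + 2), symCoeff σ α k
      = 2 * ∑ k ∈ range (n + 3), weight σ α k := by
  induction n with
  | zero => simp [symCoeff, sum_range_succ]; ring
  | succ n ih =>
    rw [sum_Ico_succ_top (by omega), sum_range_succ, mul_add, ← add_assoc, ih, symCoeff]
    ring

lemma sum_symCoeff_nonpos (σ : Shift) {α : ℝ} (h1 : 1 < α) (h2 : α < 2) {M : ℕ} (hM : 3 ≤ M) :
    symCoeff σ α 0 + 2 * ∑ k ∈ Ico 1 M, symCoeff σ α k ≤ 0 := by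
  obtain ⟨n, rfl⟩ : ∃ n, M = n + 3 := ⟨M - 3, by omega⟩
  rw [sum_symCoeff σ α (n + 1)]
  linarith [sum_weight_nonpos σ h1 h2 n]

/-- Coefficients from index 3 on are nonnegative, so the tail is a difference of two partial sums:
the later is nonpositive, and the earlier is at least minus the decay bound of the weights. -/
lemma sum_abs_symCoeff_le (σ : Shift) {α : ℝ} (h1 : 1 < α) (h2 : α < 2) (n M : ℕ) :
    ∑ k ∈ Ico (n + 3) M, |symCoeff σ α k| ≤ ((n : ℝ) + 1) ^ (-α) := by
  rcases lt_or_ge M (n + 3) with hM | hM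
  · rw [Ico_eq_empty_of_le hM.le, sum_empty]; positivity
  have e : ∑ k ∈ Ico (n + 3) M, |symCoeff σ α k| = ∑ k ∈ Ico (n + 3) M, symCoeff σ α k :=
    sum_congr rfl fun k hk => by
      obtain ⟨d, rfl⟩ : ∃ d, k = d + 3 := ⟨k - 3, by rw [mem_Ico] at hk; omega⟩
      exact abs_of_nonneg (symCoeff_nonneg σ h1 h2 d)
  obtain ⟨d, rfl⟩ : ∃ d, M = n + 3 + d := ⟨M - (n + 3), by omega⟩
  have t := sum_Ico_consecutive (symCoeff σ α) (show 1 ≤ n + 3 by omega) hM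
  have s1 := sum_symCoeff σ α (n + 1)
  have s2 := sum_symCoeff_nonpos σ h1 h2 (M := n + 3 + d) (by omega)
  have := neg_sum_weight_le σ h1 h2 n
  rw [e]
  linarith

/-! ### The `τ` matrix is negative semidefinite -/

/-- The Hankel correction removed by `τ` from the symmetric Toeplitz matrix with column `c`. -/
lemma sub_tau_apply (σ : Shift) (α : ℝ) {M : ℕ} (i j : Fin M) :
    (symG σ α M - tau (symG σ α M)) i j
      = (if (i : ℕ) + j + 2 < M then symCoeff σ α (i + j + 2) else 0)
        + (if M < (i : ℕ) + j then symCoeff σ α (2 * M - i - j) else 0) := by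
  have hi := i.2
  have hj := j.2
  have hc : ∀ k : Fin M, firstCol (symG σ α M) k = symCoeff σ α k := fun k => by
    rw [firstCol, symG_apply]; simp
  rw [tau, sub_sub_cancel, hankel, of_apply]
  by_cases h : (i : ℕ) + j < M
  · rw [dif_pos h, shiftTwo, if_neg (show ¬ M < (i : ℕ) + j by omega), add_zero]
    by_cases h' : (i : ℕ) + j + 2 < M
    · rw [dif_pos h', if_pos h', hc]
    · rw [dif_neg h', if_neg h']
  · rw [dif_neg h, if_neg (show ¬ (i : ℕ) + j + 2 < M by omega), zero_add, flip, shiftTwo]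
    simp only [Fin.val_rev]
    by_cases h' : M < (i : ℕ) + j
    · rw [dif_pos (by omega), if_pos h', hc]
      congr 1
      simp only
      omega
    · rw [dif_neg (by omega), if_neg h']

/-- Autocorrelation of a function on a cyclic group. -/
def autocorr {n : ℕ} [NeZero n] (y : ZMod n → ℝ) (k : ZMod n) : ℝ := ∑ u, y (u + k) * y u

lemma sum_sq_diff_eq {n : ℕ} [NeZero n] (y : ZMod n → ℝ) (k : ZMod n) :
    ∑ u, (y (u + k) - y u) ^ 2 = 2 * (autocorr y 0 - autocorr y k) := by
  have h : ∑ u, y (u + k) * y (u + k) = ∑ u, y u * y u :=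
    Equiv.sum_comp (Equiv.addRight k) fun u => y u * y u
  have e : ∀ u, (y (u + k) - y u) ^ 2
      = y (u + k) * y (u + k) + y u * y u - 2 * (y (u + k) * y u) := fun u => by ring
  simp only [e, sum_sub_distrib, sum_add_distrib, h, ← mul_sum, autocorr, add_zero]
  ring

lemma sum_sq_diff_two_le {n : ℕ} [NeZero n] (y : ZMod n → ℝ) :
    ∑ u, (y (u + 2) - y u) ^ 2 ≤ 4 * ∑ u, (y (u + 1) - y u) ^ 2 := by
  have h : ∑ u, (y (u + 1 + 1) - y (u + 1)) ^ 2 = ∑ u, (y (u + 1) - y u) ^ 2 :=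
    Equiv.sum_comp (Equiv.addRight 1) fun u => (y (u + 1) - y u) ^ 2
  have h2 : ∑ u, (y (u + 2) - y u) ^ 2
      ≤ ∑ u, (2 * (y (u + 1 + 1) - y (u + 1)) ^ 2 + 2 * (y (u + 1) - y u) ^ 2) := by
    refine sum_le_sum fun u _ => ?_
    rw [show u + 2 = u + 1 + 1 by ring]
    nlinarith [sq_nonneg (y (u + 1 + 1) - y (u + 1) - (y (u + 1) - y u))]
  rw [sum_add_distrib, ← mul_sum, ← mul_sum, h] at h2
  linarith

/-- Substituting R(k) = R(0) - D_k/2 turns the form into (c_0 + 2Σ c_k) R(0) - Σ c_k D_k. The only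
possibly negative c_k with k ≥ 1 is c_2, and it is compensated by c_1. -/
lemma sum_mul_autocorr_nonpos {n : ℕ} [NeZero n] (y : ZMod n → ℝ) (c : ℕ → ℝ) {M : ℕ}
    (hM : 3 ≤ M) (hc : c 0 + 2 * ∑ k ∈ Ico 1 M, c k ≤ 0) (hc1 : 0 ≤ c 1)
    (hc2 : 0 ≤ c 1 + 4 * c 2) (hc3 : ∀ k, 0 ≤ c (k + 3)) :
    c 0 * autocorr y 0 + 2 * ∑ k ∈ Ico 1 M, c k * autocorr y k ≤ 0 := by
  set D : ℕ → ℝ := fun k => ∑ u, (y (u + k) - y u) ^ 2 with hD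
  have hD0 : ∀ k, 0 ≤ D k := fun k => sum_nonneg fun u _ => sq_nonneg _
  have hR : ∀ k : ℕ, autocorr y k = autocorr y 0 - D k / 2 := fun k => by
    rw [hD]; simp only [sum_sq_diff_eq]; ring
  have h0 : 0 ≤ autocorr y 0 := by
    simp only [autocorr, add_zero]; exact sum_nonneg fun u _ => mul_self_nonneg _
  have h21 : D 2 ≤ 4 * D 1 := by
    have := sum_sq_diff_two_le y
    simp only [hD]
    push_cast
    exact this
  have hpos : 0 ≤ ∑ k ∈ Ico 1 M, c k * D k := by
    rw [← sum_Ico_consecutive _ (show 1 ≤ 3 by omega) hM]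
    refine add_nonneg ?_ (sum_nonneg fun k hk => ?_)
    · have : ∑ k ∈ Ico 1 3, c k * D k = c 1 * D 1 + c 2 * D 2 := by
        simp [sum_Ico_succ_top]
      rw [this]
      rcases le_total 0 (c 2) with h | h
      · have := mul_nonneg h (hD0 2)
        have := mul_nonneg hc1 (hD0 1)
        linarith
      · nlinarith [mul_nonneg hc2 (hD0 1), hD0 1]
    · obtain ⟨d, rfl⟩ : ∃ d, k = d + 3 := ⟨k - 3, by rw [mem_Ico] at hk; omega⟩
      exact mul_nonneg (hc3 d) (hD0 _)
  have e : ∑ k ∈ Ico 1 M, c k * autocorr y k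
      = (∑ k ∈ Ico 1 M, c k) * autocorr y 0 - (∑ k ∈ Ico 1 M, c k * D k) / 2 := by
    rw [sum_mul, sum_div, ← sum_sub_distrib]
    exact sum_congr rfl fun k _ => by rw [hR]; ring
  rw [e]
  nlinarith [mul_nonneg h0 (neg_nonneg.2 hc)]

/-- Odd extension of `x : Fin M → ℝ` (placed at `1, …, M`) to the cyclic group of order
`2 (M + 1)`. -/
def oddExt {M : ℕ} (x : Fin M → ℝ) (u : ZMod (2 * (M + 1))) : ℝ :=
  ∑ i : Fin M, x i * ((if ((i + 1 : ℕ) : ZMod (2 * (M + 1))) = u then 1 else 0)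
    - (if -((i + 1 : ℕ) : ZMod (2 * (M + 1))) = u then 1 else 0))

/-- Products of two copies of equal sign give the two Toeplitz diagonals; products of opposite sign
give, with a minus, the two antidiagonals of the Hankel corners. -/
lemma autocorr_oddExt {M : ℕ} (x : Fin M → ℝ) {k : ℕ} (hk : k < M) :
    autocorr (oddExt x) k = ∑ i : Fin M, ∑ j : Fin M, x i * x j *
      ((if (i : ℕ) = j + k then 1 else 0) + (if (j : ℕ) = i + k then 1 else 0)
        - (if k = (i : ℕ) + j + 2 then 1 else 0) - (if k + i + j = 2 * M then 1 else 0)) := by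
  have key : ∀ i j : Fin M, ∑ u : ZMod (2 * (M + 1)),
      ((if ((i + 1 : ℕ) : ZMod (2 * (M + 1))) = u + k then (1 : ℝ) else 0)
        - (if -((i + 1 : ℕ) : ZMod (2 * (M + 1))) = u + k then 1 else 0)) *
      ((if ((j + 1 : ℕ) : ZMod (2 * (M + 1))) = u then 1 else 0)
        - (if -((j + 1 : ℕ) : ZMod (2 * (M + 1))) = u then 1 else 0))
      = (if (i : ℕ) = j + k then 1 else 0) + (if (j : ℕ) = i + k then 1 else 0)
        - (if k = (i : ℕ) + j + 2 then 1 else 0) - (if k + i + j = 2 * M then 1 else 0) := by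
    intro i j
    have hi := i.2
    have hj := j.2
    have cast_eq : ∀ a b : ℕ, a < 2 * (M + 1) → b < 2 * (M + 1) →
        ((a : ZMod (2 * (M + 1))) = b ↔ a = b) := fun a b ha hb => by
      rw [ZMod.natCast_eq_natCast_iff', Nat.mod_eq_of_lt ha, Nat.mod_eq_of_lt hb]
    have c1 : ((i + 1 : ℕ) : ZMod (2 * (M + 1))) = ((j + 1 : ℕ) : ZMod (2 * (M + 1))) + k
        ↔ (i : ℕ) = j + k := by
      rw [← Nat.cast_add, cast_eq _ _ (by omega) (by omega)]; omega
    have c2 : ((i + 1 : ℕ) : ZMod (2 * (M + 1))) = -((j + 1 : ℕ) : ZMod (2 * (M + 1))) + k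
        ↔ k = (i : ℕ) + j + 2 := by
      rw [neg_add_eq_sub, eq_sub_iff_add_eq, ← Nat.cast_add, cast_eq _ _ (by omega) (by omega)]
      omega
    -- The number (i+1) + (j+1) + k lies strictly between 0 and 4(M+1), so divisibility by 2(M+1)
    -- forces equality.
    have c3 : -((i + 1 : ℕ) : ZMod (2 * (M + 1))) = ((j + 1 : ℕ) : ZMod (2 * (M + 1))) + k
        ↔ k + i + j = 2 * M := by
      rw [neg_eq_iff_add_eq_zero, ← Nat.cast_add, ← Nat.cast_add, ZMod.natCast_eq_zero_iff]
      constructor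
      · rintro ⟨t, ht⟩
        have h1 : t ≠ 0 := by rintro rfl; omega
        have h2 : t < 2 := by
          by_contra h
          have := Nat.mul_le_mul_left (2 * (M + 1)) (not_lt.1 h)
          omega
        obtain rfl : t = 1 := by omega
        omega
      · intro h
        exact ⟨1, by omega⟩
    have c4 : -((i + 1 : ℕ) : ZMod (2 * (M + 1))) = -((j + 1 : ℕ) : ZMod (2 * (M + 1))) + k
        ↔ (j : ℕ) = i + k := by
      rw [neg_add_eq_sub, eq_sub_iff_add_eq, neg_add_eq_sub, sub_eq_iff_eq_add, ← Nat.cast_add,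
        cast_eq _ _ (by omega) (by omega)]
      omega
    simp only [mul_sub, mul_ite, mul_one, mul_zero, sum_sub_distrib, sum_ite_eq, mem_univ, if_true,
      c1, c2, c3, c4]
    ring
  simp only [autocorr, oddExt, sum_mul_sum]
  rw [sum_comm]
  refine sum_congr rfl fun i _ => ?_
  rw [sum_comm]
  refine sum_congr rfl fun j _ => ?_
  rw [← key i j, mul_sum]
  exact sum_congr rfl fun u _ => by ring

lemma sum_Ico_mul_ite (c : ℕ → ℝ) {M : ℕ} (p : ℕ → Prop) [DecidablePred p] (a : ℕ)
    (h : ∀ k ∈ Ico 1 M, p k ↔ k = a) :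
    ∑ k ∈ Ico 1 M, c k * (if p k then 1 else 0) = if 1 ≤ a ∧ a < M then c a else 0 := by
  have e : ∑ k ∈ Ico 1 M, c k * (if p k then 1 else 0)
      = ∑ k ∈ Ico 1 M, if k = a then c k else 0 :=
    sum_congr rfl fun k hk => by simp only [h k hk, mul_ite, mul_one, mul_zero]
  rw [e, sum_ite_eq']
  simp only [mem_Ico]

/-- The kernel multiplying c_k is that of the k-th autocorrelation of the odd extension. At k = 0
both Toeplitz indicators fire on the diagonal, which is why c_0 is not doubled while the other
coefficients are. -/
lemma tau_apply (σ : Shift) (α : ℝ) {M : ℕ} (i j : Fin M) :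
    2 * tau (symG σ α M) i j = symCoeff σ α 0 *
      ((if (i : ℕ) = j + 0 then 1 else 0) + (if (j : ℕ) = i + 0 then 1 else 0)
        - (if 0 = (i : ℕ) + j + 2 then 1 else 0) - (if 0 + (i : ℕ) + j = 2 * M then 1 else 0))
      + 2 * ∑ k ∈ Ico 1 M, symCoeff σ α k *
      ((if (i : ℕ) = j + k then 1 else 0) + (if (j : ℕ) = i + k then 1 else 0)
        - (if k = (i : ℕ) + j + 2 then 1 else 0) - (if k + i + j = 2 * M then 1 else 0)) := by
  have hi := i.2
  have hj := j.2
  have hs := sub_tau_apply σ α i j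
  rw [Matrix.sub_apply, symG_apply] at hs
  simp only [mul_sub, mul_add, sum_sub_distrib, sum_add_distrib]
  rw [sum_Ico_mul_ite _ (fun k => (i : ℕ) = j + k) (i - j) fun k hk => by rw [mem_Ico] at hk; omega,
    sum_Ico_mul_ite _ (fun k => (j : ℕ) = i + k) (j - i) fun k hk => by rw [mem_Ico] at hk; omega,
    sum_Ico_mul_ite _ (fun k => k = (i : ℕ) + j + 2) (i + j + 2) fun k _ => Iff.rfl,
    sum_Ico_mul_ite _ (fun k => k + (i : ℕ) + j = 2 * M) (2 * M - i - j) fun k _ => by omega]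
  have q1 : (1 ≤ (i : ℕ) + j + 2 ∧ (i : ℕ) + j + 2 < M) ↔ (i : ℕ) + j + 2 < M := by omega
  have q2 : (1 ≤ 2 * M - (i : ℕ) - j ∧ 2 * M - (i : ℕ) - j < M) ↔ M < (i : ℕ) + j := by omega
  simp only [q1, q2]
  rw [if_neg (show ¬ 0 = (i : ℕ) + j + 2 by omega),
    if_neg (show ¬ 0 + (i : ℕ) + j = 2 * M by omega)]
  have hT : 2 * symCoeff σ α ((i : ℕ) - j + (j - i))
      = symCoeff σ α 0 * (if (i : ℕ) = j + 0 then 1 else 0)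
        + symCoeff σ α 0 * (if (j : ℕ) = i + 0 then 1 else 0)
        + 2 * (if 1 ≤ (i : ℕ) - j ∧ (i : ℕ) - j < M then symCoeff σ α (i - j) else 0)
        + 2 * (if 1 ≤ (j : ℕ) - i ∧ (j : ℕ) - i < M then symCoeff σ α (j - i) else 0) := by
    rcases lt_trichotomy (i : ℕ) j with h | h | h
    · rw [if_neg (by omega), if_neg (by omega), if_neg (by omega), if_pos (by omega),
        show (i : ℕ) - j + (j - i) = j - i by omega]
      ring
    · rw [if_pos (by omega), if_pos (by omega), if_neg (by omega), if_neg (by omega), h]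
      simp; ring
    · rw [if_neg (by omega), if_neg (by omega), if_pos (by omega), if_neg (by omega),
        show (i : ℕ) - j + (j - i) = i - j by omega]
      ring
  linarith

lemma symG_isHermitian (σ : Shift) (α : ℝ) (M : ℕ) : (symG σ α M).IsHermitian := by
  refine IsHermitian.ext fun i j => ?_
  rw [star_trivial, symG_apply, symG_apply, add_comm]

lemma tau_symG_isHermitian (σ : Shift) (α : ℝ) (M : ℕ) : (tau (symG σ α M)).IsHermitian := by
  have h : (symG σ α M - tau (symG σ α M)).IsHermitian := by
    refine IsHermitian.ext fun i j => ?_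
    rw [star_trivial, sub_tau_apply, sub_tau_apply, add_comm (j : ℕ) i, Nat.sub_right_comm]
  simpa using (symG_isHermitian σ α M).sub h

/-- `-τ(G)` is positive semidefinite. -/
lemma neg_tau_symG_posSemidef (σ : Shift) {α : ℝ} (h1 : 1 < α) (h2 : α < 2) {M : ℕ} (hM : 3 ≤ M) :
    (-tau (symG σ α M)).PosSemidef := by
  refine .of_dotProduct_mulVec_nonneg (tau_symG_isHermitian σ α M).neg fun x => ?_
  rw [star_trivial, neg_mulVec, dotProduct_neg, neg_nonneg]
  have h := sum_mul_autocorr_nonpos (oddExt x) (symCoeff σ α) hM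
    (sum_symCoeff_nonpos σ h1 h2 hM) (symCoeff_one_nonneg σ h1 h2)
    (symCoeff_one_add_nonneg σ h1 h2) (symCoeff_nonneg σ h1 h2)
  let E : ℕ → Fin M → Fin M → ℝ := fun k i j =>
    (if (i : ℕ) = j + k then 1 else 0) + (if (j : ℕ) = i + k then 1 else 0)
      - (if k = (i : ℕ) + j + 2 then 1 else 0) - (if k + i + j = 2 * M then 1 else 0)
  have hR : ∀ k < M, autocorr (oddExt x) k = ∑ i, ∑ j, x i * x j * E k i j :=
    fun k hk => autocorr_oddExt x hk
  have ht : ∀ i j, 2 * tau (symG σ α M) i j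
      = symCoeff σ α 0 * E 0 i j + 2 * ∑ k ∈ Ico 1 M, symCoeff σ α k * E k i j :=
    fun i j => tau_apply σ α i j
  have h0 := hR 0 (by omega)
  rw [Nat.cast_zero] at h0
  rw [h0, sum_congr (s₁ := Ico 1 M) rfl fun k hk =>
    congrArg (symCoeff σ α k * ·) (hR k (mem_Ico.1 hk).2)] at h
  have e : 2 * (x ⬝ᵥ tau (symG σ α M) *ᵥ x)
      = ∑ i, ∑ j, x i * x j * (2 * tau (symG σ α M) i j) := by
    simp only [dotProduct, mulVec, mul_sum]
    exact sum_congr rfl fun i _ => sum_congr rfl fun j _ => by ring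
  have e2 : 2 * (x ⬝ᵥ tau (symG σ α M) *ᵥ x) ≤ 0 := by
    refine le_of_eq_of_le ?_ h
    rw [e]
    simp only [ht, mul_add, sum_add_distrib]
    congr 1
    · simp only [mul_sum]
      exact sum_congr rfl fun i _ => sum_congr rfl fun j _ => by ring
    · simp only [mul_sum]
      symm
      rw [sum_comm]
      refine sum_congr rfl fun i _ => ?_
      rw [sum_comm]
      exact sum_congr rfl fun j _ => sum_congr rfl fun k _ => by ring
  linarith

/-! ### Negligibility of the Hankel corrections -/

lemma sum_ite_le_sum_Ico {ι : Type*} (A : Finset ι) (p : ι → Prop) [DecidablePred p] (f : ι → ℕ)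
    (hf : Function.Injective f) (c : ℕ → ℝ) {m M : ℕ}
    (h : ∀ j ∈ A, p j → m ≤ f j ∧ f j < M) :
    ∑ j ∈ A, |if p j then c (f j) else 0| ≤ ∑ k ∈ Ico m M, |c k| := by
  classical
  have e : ∑ j ∈ A, |if p j then c (f j) else 0| = ∑ k ∈ (A.filter p).image f, |c k| := by
    rw [sum_image fun _ _ _ _ h => hf h, sum_filter]
    exact sum_congr rfl fun j _ => by split_ifs <;> simp
  rw [e]
  refine sum_le_sum_of_subset_of_nonneg (fun k hk => ?_) fun _ _ _ => abs_nonneg _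
  obtain ⟨j, hj, rfl⟩ := mem_image.1 hk
  rw [mem_filter] at hj
  exact mem_Ico.2 (h j hj.1 hj.2)

/-- Along a row, each of the two corners meets a given coefficient at most once, whence the factor
2. -/
lemma sum_abs_sub_tau_le (σ : Shift) (α : ℝ) {M : ℕ} (m : ℕ) (A : Finset (Fin M)) (i : Fin M)
    (h : ∀ j ∈ A, m ≤ (i : ℕ) + j + 2 ∧ m + i + j ≤ 2 * M) :
    ∑ j ∈ A, |(symG σ α M - tau (symG σ α M)) i j| ≤ 2 * ∑ k ∈ Ico m M, |symCoeff σ α k| := by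
  have hi := i.2
  simp only [sub_tau_apply]
  rw [two_mul (∑ _ ∈ _, _)]
  refine le_trans (sum_le_sum fun j _ => abs_add_le _ _) ?_
  rw [sum_add_distrib]
  refine add_le_add ?_ ?_
  · refine sum_ite_le_sum_Ico A (fun j : Fin M => (i : ℕ) + j + 2 < M)
      (fun j : Fin M => (i : ℕ) + j + 2) (fun a b hab => ?_) (symCoeff σ α) fun j hj hp => ?_
    · ext; simp only at hab; omega
    · exact ⟨(h j hj).1, hp⟩
  · refine sum_ite_le_sum_Ico A (fun j : Fin M => M < (i : ℕ) + j)
      (fun j : Fin M => 2 * M - (i : ℕ) - j) (fun a b hab => ?_) (symCoeff σ α) fun j hj hp => ?_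
    · ext; have := a.2; have := b.2; simp only at hab; omega
    · have := (h j hj).2; omega

/-- The indices at distance at least `m` from both ends. -/
def middle (M m : ℕ) : Finset (Fin M) := {i | m ≤ (i : ℕ) ∧ (i : ℕ) + m < M}

lemma card_compl_middle_le (M m : ℕ) : #(middle M m)ᶜ ≤ 2 * m := by
  have h : #(middle M m)ᶜ ≤ #(range m ∪ Ico (M - m) M) := by
    refine card_le_card_of_injOn (fun i => (i : ℕ)) (fun i hi => ?_)
      (Fin.val_injective.injOn)
    have := i.2
    simp only [middle, coe_compl, coe_filter, Set.mem_compl_iff, Set.mem_ofPred_eq, mem_univ,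
      true_and] at hi
    simp only [coe_union, coe_range, coe_Ico, Set.mem_union, Set.mem_Iio, Set.mem_Ico]
    omega
  have := h.trans (card_union_le _ _)
  rw [card_range, Nat.card_Ico] at this
  omega

/-- A scaled Hankel correction is negligible as soon as the scaling is `o(M ^ α)`. -/
lemma negligible_sub_tau (σ : Shift) {α : ℝ} (h1 : 1 < α) (h2 : α < 2) {M : ℕ → ℕ} {a : ℕ → ℝ}
    (hM : Tendsto M atTop atTop) (ha : Tendsto (fun k => a k * (M k : ℝ) ^ (-α)) atTop (𝓝 0)) :
    Negligible fun k => a k • (symG σ α (M k) - tau (symG σ α (M k))) := by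
  intro η hη
  have hMr : Tendsto (fun k => (M k : ℝ)) atTop atTop := tendsto_natCast_atTop_atTop.comp hM
  have ha' : Tendsto (fun k => 2 * (η / 4) ^ (-α) * |a k * (M k : ℝ) ^ (-α)|) atTop (𝓝 0) := by
    simpa using (ha.abs.const_mul (2 * (η / 4) ^ (-α)))
  -- With ηM ≥ 16 the floor m of ηM/2 is at least 3, and n + 1 = m - 2 > ηM/2 - 3 ≥ ηM/4. The
  -- deleted columns number at most 2m ≤ ηM.
  filter_upwards [hMr.eventually_ge_atTop (16 / η), ha'.eventually (gt_mem_nhds hη),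
    hMr.eventually_gt_atTop 0] with k hk hak hk0
  have hk' : 16 ≤ η * M k := by rwa [div_le_iff₀' hη] at hk
  set m := ⌊η * M k / 2⌋₊ with hm
  have hm1 : (m : ℝ) ≤ η * M k / 2 := Nat.floor_le (by positivity)
  have hm2 : η * M k / 2 < (m : ℝ) + 1 := Nat.lt_floor_add_one _
  have hm3 : 3 ≤ m := Nat.le_floor (by push_cast; linarith)
  obtain ⟨n, hn⟩ : ∃ n, m = n + 3 := ⟨m - 3, by omega⟩
  have hn' : (m : ℝ) = n + 3 := by exact_mod_cast hn
  have hbase : η / 4 * M k ≤ (n : ℝ) + 1 := by linarith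
  have htail : ∑ k' ∈ Ico m (M k), |symCoeff σ α k'| ≤ (η / 4) ^ (-α) * (M k : ℝ) ^ (-α) := by
    rw [hn, ← Real.mul_rpow (by positivity) (by positivity)]
    exact (sum_abs_symCoeff_le σ h1 h2 n _).trans
      (Real.rpow_le_rpow_of_nonpos (by positivity) hbase (by linarith))
  have hsum : |a k| * (2 * ∑ k' ∈ Ico m (M k), |symCoeff σ α k'|) ≤ η := by
    refine le_trans (mul_le_mul_of_nonneg_left
      (mul_le_mul_of_nonneg_left htail (by norm_num)) (abs_nonneg _)) ?_
    rw [abs_mul, abs_of_nonneg (show (0 : ℝ) ≤ (M k : ℝ) ^ (-α) by positivity)] at hak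
    linarith
  refine ⟨middle (M k) m, ?_, fun i => ?_, fun j hj => ?_⟩
  · have : (#(middle (M k) m)ᶜ : ℝ) ≤ 2 * m := by exact_mod_cast card_compl_middle_le (M k) m
    rw [Fintype.card_fin]
    linarith
  · simp only [Matrix.smul_apply, smul_eq_mul, abs_mul, ← mul_sum]
    refine le_trans (mul_le_mul_of_nonneg_left (sum_abs_sub_tau_le σ α m _ i fun j hj => ?_)
      (abs_nonneg _)) hsum
    have := i.2
    simp only [middle, mem_filter, mem_univ, true_and] at hj
    omega
  · have hsymm : ∀ i, (symG σ α (M k) - tau (symG σ α (M k))) i j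
        = (symG σ α (M k) - tau (symG σ α (M k))) j i := fun i => by
      rw [← ((symG_isHermitian σ α (M k)).sub (tau_symG_isHermitian σ α (M k))).apply i j,
        star_trivial]
    simp only [Matrix.smul_apply, smul_eq_mul, abs_mul, ← mul_sum, hsymm]
    refine le_trans (mul_le_mul_of_nonneg_left (sum_abs_sub_tau_le σ α m _ j fun i _ => ?_)
      (abs_nonneg _)) hsum
    have := i.2
    simp only [middle, mem_filter, mem_univ, true_and] at hj
    omega

/-! ### The coefficient matrices -/

lemma spaceStep_pos {a b : ℝ} (hab : a < b) (M : ℕ) : 0 < spaceStep a b M :=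
  div_pos (sub_pos.2 hab) (by positivity)

lemma timeStep_pos {T : ℝ} (hT : 0 < T) {N : ℕ} (hN : 1 ≤ N) : 0 < timeStep T N :=
  div_pos hT (by exact_mod_cast hN)

lemma cos_neg_of_order {α : ℝ} (h1 : 1 < α) (h2 : α < 2) : Real.cos (α * Real.pi / 2) < 0 :=
  Real.cos_neg_of_pi_div_two_lt_of_lt (by nlinarith [Real.pi_pos]) (by nlinarith [Real.pi_pos])

lemma cbar_pos {α h : ℝ} (h1 : 1 < α) (h2 : α < 2) (hh : 0 < h) : 0 < cbar α h := by
  have hc := cos_neg_of_order h1 h2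
  have hp : 0 < h ^ α := Real.rpow_pos_of_pos hh _
  rw [cbar, neg_pos, inv_lt_zero]
  exact mul_neg_of_pos_of_neg (by positivity) hc

lemma gam_eq (α ht h : ℝ) : gam α ht h = ht * cbar α h := by
  rw [gam, cbar, div_eq_mul_inv]; ring

lemma gam_pos {α ht h : ℝ} (h1 : 1 < α) (h2 : α < 2) (hht : 0 < ht) (hh : 0 < h) :
    0 < gam α ht h := by
  rw [gam_eq]; exact mul_pos hht (cbar_pos h1 h2 hh)

/-- The product is a constant times (hM)^{-α}, and hM = (b-a)M/(M+1) ≥ (b-a)/2. -/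
lemma exists_cbar_mul_rpow_le {α a b : ℝ} (h1 : 1 < α) (h2 : α < 2) (hab : a < b) :
    ∃ K : ℝ, 0 ≤ K ∧ ∀ M : ℕ, 1 ≤ M → cbar α (spaceStep a b M) * (M : ℝ) ^ (-α) ≤ K := by
  have hc := cos_neg_of_order h1 h2
  have hK : 0 ≤ -(2 * Real.cos (α * Real.pi / 2))⁻¹ := by
    rw [neg_nonneg, inv_nonpos]; linarith
  refine ⟨-(2 * Real.cos (α * Real.pi / 2))⁻¹ * ((b - a) / 2) ^ (-α),
    mul_nonneg hK (Real.rpow_nonneg (by linarith) _), fun M hM => ?_⟩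
  have hM' : (1 : ℝ) ≤ M := by exact_mod_cast hM
  have hs := spaceStep_pos hab M
  have e : cbar α (spaceStep a b M) * (M : ℝ) ^ (-α)
      = -(2 * Real.cos (α * Real.pi / 2))⁻¹ * (spaceStep a b M * M) ^ (-α) := by
    rw [Real.mul_rpow hs.le (by positivity), Real.rpow_neg hs.le, cbar]
    simp only [mul_inv]
    ring
  rw [e]
  refine mul_le_mul_of_nonneg_left (Real.rpow_le_rpow_of_nonpos (by linarith) ?_ (by linarith)) hK
  rw [spaceStep, div_mul_eq_mul_div, div_le_div_iff₀ (by norm_num) (by positivity)]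
  nlinarith

/-- Scaling of the unnormalised difference: h_t → 0 alone makes it o(M^α), with no relation between
M and N. -/
lemma tendsto_scaling {ε T α a b : ℝ} (hT : 0 < T) (h1 : 1 < α) (h2 : α < 2) (hab : a < b)
    {M N : ℕ → ℕ} (hM : ∀ k, 1 ≤ M k) (hN : Tendsto N atTop atTop) :
    Tendsto (fun k => -(ε ^ 2 * timeStep T (N k) * cbar α (spaceStep a b (M k)))
      * (M k : ℝ) ^ (-α)) atTop (𝓝 0) := by
  obtain ⟨K, hK0, hK⟩ := exists_cbar_mul_rpow_le h1 h2 hab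
  have hlim : Tendsto (fun k => ε ^ 2 * K * timeStep T (N k)) atTop (𝓝 0) := by
    simpa [timeStep] using ((tendsto_const_div_atTop_nhds_zero_nat T).comp hN).const_mul (ε ^ 2 * K)
  refine squeeze_zero_norm (fun k => ?_) hlim
  have hc := cbar_pos h1 h2 (spaceStep_pos hab (M k))
  have ht : 0 ≤ timeStep T (N k) := div_nonneg hT.le (Nat.cast_nonneg _)
  have hp : 0 ≤ (M k : ℝ) ^ (-α) := by positivity
  rw [neg_mul, norm_neg, Real.norm_of_nonneg (by positivity)]
  have := mul_le_mul_of_nonneg_left (hK (M k) (hM k))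
    (show 0 ≤ ε ^ 2 * timeStep T (N k) by positivity)
  linarith

/-- Scaling after division by γ, where the growth of M^α does all the work. -/
lemma tendsto_scaling_of_bounded {α C : ℝ} (h1 : 1 < α) {M : ℕ → ℕ} {r : ℕ → ℝ}
    (hM : Tendsto M atTop atTop) (hr : ∀ k, |r k| ≤ C) :
    Tendsto (fun k => r k * (M k : ℝ) ^ (-α)) atTop (𝓝 0) := by
  have hlim : Tendsto (fun k => C * (M k : ℝ) ^ (-α)) atTop (𝓝 0) := by
    simpa using ((tendsto_rpow_neg_atTop (show 0 < α by linarith)).comp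
      (tendsto_natCast_atTop_atTop.comp hM)).const_mul C
  refine squeeze_zero_norm (fun k => ?_) hlim
  have hp : 0 ≤ (M k : ℝ) ^ (-α) := by positivity
  rw [norm_mul, Real.norm_of_nonneg hp]
  exact mul_le_mul_of_nonneg_right (hr k) hp

lemma coeff1_sub_prec1 (σ : Shift) (ε s α ht h : ℝ) (M : ℕ) :
    coeff1 σ ε s α ht h M - prec1 σ ε s α ht h M
      = (-(ε ^ 2 * ht * cbar α h)) • (symG σ α M - tau (symG σ α M)) := by
  rw [coeff1, prec1, smul_sub, neg_smul, neg_smul]; abel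

lemma coeff2_sub_prec2 (σ : Shift) (ε s α₁ α₂ ht h₁ h₂ : ℝ) (M₁ M₂ : ℕ) :
    coeff2 σ ε s α₁ α₂ ht h₁ h₂ M₁ M₂ - prec2 σ ε s α₁ α₂ ht h₁ h₂ M₁ M₂
      = ((-(ε ^ 2 * ht * cbar α₁ h₁)) • (symG σ α₁ M₁ - tau (symG σ α₁ M₁)))
          ⊗ₖ (1 : Matrix (Fin M₂) (Fin M₂) ℝ)
        + (1 : Matrix (Fin M₁) (Fin M₁) ℝ)
          ⊗ₖ ((-(ε ^ 2 * ht * cbar α₂ h₂)) • (symG σ α₂ M₂ - tau (symG σ α₂ M₂))) := by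
  ext i j
  simp only [coeff2, prec2, Matrix.sub_apply, Matrix.add_apply, Matrix.smul_apply,
    kroneckerMap_apply, smul_eq_mul]
  ring

lemma smul_coeff2_sub_prec2 (σ : Shift) (c ε s α₁ α₂ ht h₁ h₂ : ℝ) (M₁ M₂ : ℕ) :
    c • (coeff2 σ ε s α₁ α₂ ht h₁ h₂ M₁ M₂ - prec2 σ ε s α₁ α₂ ht h₁ h₂ M₁ M₂)
      = ((-(c * (ε ^ 2 * gam α₁ ht h₁))) • (symG σ α₁ M₁ - tau (symG σ α₁ M₁)))
          ⊗ₖ (1 : Matrix (Fin M₂) (Fin M₂) ℝ)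
        + (1 : Matrix (Fin M₁) (Fin M₁) ℝ)
          ⊗ₖ ((-(c * (ε ^ 2 * gam α₂ ht h₂))) • (symG σ α₂ M₂ - tau (symG σ α₂ M₂))) := by
  rw [coeff2_sub_prec2, gam_eq, gam_eq]
  ext i j
  simp only [Matrix.add_apply, Matrix.smul_apply, kroneckerMap_apply, smul_eq_mul]
  ring

/-! ### Symmetry and positivity of the coefficient matrices and preconditioners -/

lemma isHermitian_smul_real {n : Type*} {A : Matrix n n ℝ} (hA : A.IsHermitian) (c : ℝ) :
    (c • A).IsHermitian := by
  rw [IsHermitian, conjTranspose_smul, hA.eq, star_trivial]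

lemma isHermitian_kronecker {m n : Type*} {A : Matrix m m ℝ} {B : Matrix n n ℝ}
    (hA : A.IsHermitian) (hB : B.IsHermitian) : (A ⊗ₖ B).IsHermitian := by
  rw [IsHermitian, conjTranspose_kronecker, hA.eq, hB.eq]

lemma coeff1_isHermitian (σ : Shift) (ε s α ht h : ℝ) (M : ℕ) :
    (coeff1 σ ε s α ht h M).IsHermitian :=
  (isHermitian_smul_real isHermitian_one _).sub (isHermitian_smul_real (symG_isHermitian _ _ _) _)

lemma prec1_isHermitian (σ : Shift) (ε s α ht h : ℝ) (M : ℕ) :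
    (prec1 σ ε s α ht h M).IsHermitian :=
  (isHermitian_smul_real isHermitian_one _).sub
    (isHermitian_smul_real (tau_symG_isHermitian _ _ _) _)

lemma coeff2_isHermitian (σ : Shift) (ε s α₁ α₂ ht h₁ h₂ : ℝ) (M₁ M₂ : ℕ) :
    (coeff2 σ ε s α₁ α₂ ht h₁ h₂ M₁ M₂).IsHermitian :=
  (isHermitian_smul_real isHermitian_one _).sub (isHermitian_smul_real
    ((isHermitian_kronecker (isHermitian_smul_real (symG_isHermitian _ _ _) _)
      isHermitian_one).add (isHermitian_kronecker isHermitian_one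
        (isHermitian_smul_real (symG_isHermitian _ _ _) _))) _)

lemma prec2_isHermitian (σ : Shift) (ε s α₁ α₂ ht h₁ h₂ : ℝ) (M₁ M₂ : ℕ) :
    (prec2 σ ε s α₁ α₂ ht h₁ h₂ M₁ M₂).IsHermitian :=
  (isHermitian_smul_real isHermitian_one _).sub (isHermitian_smul_real
    ((isHermitian_kronecker (isHermitian_smul_real (tau_symG_isHermitian _ _ _) _)
      isHermitian_one).add (isHermitian_kronecker isHermitian_one
        (isHermitian_smul_real (tau_symG_isHermitian _ _ _) _))) _)

lemma prec1_sub_one_posSemidef (σ : Shift) {ε s α ht h : ℝ} (hs : 0 < s) (h1 : 1 < α)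
    (h2 : α < 2) (hht : 0 < ht) (hh : 0 < h) {M : ℕ} (hM : 3 ≤ M) :
    (prec1 σ ε s α ht h M - 1).PosSemidef := by
  have hc := cbar_pos h1 h2 hh
  have e : prec1 σ ε s α ht h M - 1 = (s * ht) • (1 : Matrix (Fin M) (Fin M) ℝ)
      + (ε ^ 2 * ht * cbar α h) • (-tau (symG σ α M)) := by
    rw [prec1, add_smul, one_smul, smul_neg]; abel
  rw [e]
  exact (PosSemidef.one.smul (by positivity)).add
    ((neg_tau_symG_posSemidef σ h1 h2 hM).smul (by positivity))

lemma prec2_sub_one_posSemidef (σ : Shift) {ε s α₁ α₂ ht h₁ h₂ : ℝ} (hs : 0 < s) (h11 : 1 < α₁)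
    (h12 : α₁ < 2) (h21 : 1 < α₂) (h22 : α₂ < 2) (hht : 0 < ht) (hh₁ : 0 < h₁) (hh₂ : 0 < h₂)
    {M₁ M₂ : ℕ} (hM₁ : 3 ≤ M₁) (hM₂ : 3 ≤ M₂) :
    (prec2 σ ε s α₁ α₂ ht h₁ h₂ M₁ M₂ - 1).PosSemidef := by
  have hc₁ := cbar_pos h11 h12 hh₁
  have hc₂ := cbar_pos h21 h22 hh₂
  have e : prec2 σ ε s α₁ α₂ ht h₁ h₂ M₁ M₂ - 1
      = (s * ht) • (1 : Matrix (Fin M₁ × Fin M₂) (Fin M₁ × Fin M₂) ℝ) + (ε ^ 2 * ht) •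
        ((cbar α₁ h₁ • -tau (symG σ α₁ M₁)) ⊗ₖ (1 : Matrix (Fin M₂) (Fin M₂) ℝ) +
        (1 : Matrix (Fin M₁) (Fin M₁) ℝ) ⊗ₖ (cbar α₂ h₂ • -tau (symG σ α₂ M₂))) := by
    ext i j
    simp only [prec2, Matrix.sub_apply, Matrix.add_apply, Matrix.smul_apply, Matrix.neg_apply,
      kroneckerMap_apply, smul_eq_mul]
    ring
  rw [e]
  exact (PosSemidef.one.smul (by positivity)).add
    (((((neg_tau_symG_posSemidef σ h11 h12 hM₁).smul hc₁.le).kronecker PosSemidef.one).add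
      (PosSemidef.one.kronecker ((neg_tau_symG_posSemidef σ h21 h22 hM₂).smul hc₂.le))).smul
        (by positivity))

/-- The conclusions shared by the one- and two-dimensional problems, for abstract sequences. -/
lemma preconditioning {I : ℕ → Type*} [∀ k, Fintype (I k)] [∀ k, DecidableEq (I k)]
    [∀ k, Nonempty (I k)] (d : ℕ) {A P : ∀ k, Matrix (I k) (I k) ℝ} {γ : ℕ → ℝ}
    (hγ : ∀ k, γ k ≠ 0) (hA : ∀ k, (A k).IsHermitian) (hP : ∀ k, (P k).IsHermitian)
    (hP1 : ∀ᶠ k in atTop, (P k - 1).PosSemidef) (h : Negligible fun k => A k - P k)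
    (h' : Negligible fun k => (γ k)⁻¹ • A k - (γ k)⁻¹ • P k) :
    ZeroDistributed d (fun k => toComplex (A k - P k)) ∧
    ZeroDistributed d (fun k => toComplex ((γ k)⁻¹ • A k - (γ k)⁻¹ • P k)) ∧
    (∀ᶠ k in atTop, IsUnit (P k) ∧ IsUnit ((γ k)⁻¹ • P k)) ∧
    WeaklyClusteredAt (fun k => toComplex ((P k)⁻¹ * A k)) 1 ∧
    WeaklyClusteredAt (fun k => toComplex (((γ k)⁻¹ • P k)⁻¹ * ((γ k)⁻¹ • A k))) 1 := by
  have hunit : ∀ᶠ k in atTop, IsUnit (P k) := hP1.mono fun k hk => by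
    have := PosDef.one.add_posSemidef hk
    rw [add_sub_cancel] at this
    exact this.isUnit
  have hcl := weaklyClusteredAt_inv_mul h hA hP1
  refine ⟨(h.weaklyClusteredAt_zero fun k => (hA k).sub (hP k)).zeroDistributed d,
    (h'.weaklyClusteredAt_zero fun k => (isHermitian_smul_real (hA k) _).sub
      (isHermitian_smul_real (hP k) _)).zeroDistributed d, ?_, hcl, hcl.congr ?_⟩
  · filter_upwards [hunit] with k hk
    exact ⟨hk, (isUnit_smul_iff (Units.mk0 _ (inv_ne_zero (hγ k))) (P k)).2 hk⟩
  -- The scalars cancel, so the normalised product coincides with P⁻¹A once P is invertible.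
  · filter_upwards [hunit] with k hk
    have hinv : ((γ k)⁻¹ • P k)⁻¹ = γ k • (P k)⁻¹ := by
      refine inv_eq_left_inv ?_
      rw [smul_mul_smul_comm, mul_inv_cancel₀ (hγ k), one_smul,
        nonsing_inv_mul _ ((isUnit_iff_isUnit_det _).1 hk)]
    rw [hinv, smul_mul_smul_comm, mul_inv_cancel₀ (hγ k), one_smul]

end SFAC

theorem theorem5p1 (σ : SFAC.Shift) (ε s T : ℝ) (hε : 0 < ε) (hs : 0 < s) (hT : 0 < T) :
    -- one space dimension, on the interval (a, b)
    (∀ (α a b : ℝ), 1 < α → α < 2 → a < b →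
      ∀ (M N : ℕ → ℕ), (∀ k, 1 ≤ M k) → (∀ k, 1 ≤ N k) →
        Tendsto M atTop atTop → Tendsto N atTop atTop →
      let ht : ℕ → ℝ := fun k => SFAC.timeStep T (N k)
      let h : ℕ → ℝ := fun k => SFAC.spaceStep a b (M k)
      let γ : ℕ → ℝ := fun k => SFAC.gam α (ht k) (h k)
      let A : ∀ k, Matrix (Fin (M k)) (Fin (M k)) ℝ :=
        fun k => SFAC.coeff1 σ ε s α (ht k) (h k) (M k)
      let P : ∀ k, Matrix (Fin (M k)) (Fin (M k)) ℝ :=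
        fun k => SFAC.prec1 σ ε s α (ht k) (h k) (M k)
      let Ahat : ∀ k, Matrix (Fin (M k)) (Fin (M k)) ℝ := fun k => (γ k)⁻¹ • A k
      let Phat : ∀ k, Matrix (Fin (M k)) (Fin (M k)) ℝ := fun k => (γ k)⁻¹ • P k
      SFAC.ZeroDistributed 1 (fun k => SFAC.toComplex (A k - P k)) ∧
      SFAC.ZeroDistributed 1 (fun k => SFAC.toComplex (Ahat k - Phat k)) ∧
      (∀ᶠ k in atTop, IsUnit (P k) ∧ IsUnit (Phat k)) ∧
      SFAC.WeaklyClusteredAt (fun k => SFAC.toComplex ((P k)⁻¹ * A k)) 1 ∧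
      SFAC.WeaklyClusteredAt (fun k => SFAC.toComplex ((Phat k)⁻¹ * Ahat k)) 1) ∧
    -- two space dimensions, on the rectangle (a₁, b₁) × (a₂, b₂)
    (∀ (α₁ α₂ a₁ b₁ a₂ b₂ : ℝ), 1 < α₁ → α₁ < 2 → 1 < α₂ → α₂ < 2 → a₁ < b₁ → a₂ < b₂ →
      ∀ (M₁ M₂ N : ℕ → ℕ), (∀ k, 1 ≤ M₁ k) → (∀ k, 1 ≤ M₂ k) → (∀ k, 1 ≤ N k) →
        Tendsto M₁ atTop atTop → Tendsto M₂ atTop atTop → Tendsto N atTop atTop →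
      let ht : ℕ → ℝ := fun k => SFAC.timeStep T (N k)
      let h₁ : ℕ → ℝ := fun k => SFAC.spaceStep a₁ b₁ (M₁ k)
      let h₂ : ℕ → ℝ := fun k => SFAC.spaceStep a₂ b₂ (M₂ k)
      let γ : ℕ → ℝ := fun k => max (SFAC.gam α₁ (ht k) (h₁ k)) (SFAC.gam α₂ (ht k) (h₂ k))
      let A : ∀ k, Matrix (Fin (M₁ k) × Fin (M₂ k)) (Fin (M₁ k) × Fin (M₂ k)) ℝ :=
        fun k => SFAC.coeff2 σ ε s α₁ α₂ (ht k) (h₁ k) (h₂ k) (M₁ k) (M₂ k)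
      let P : ∀ k, Matrix (Fin (M₁ k) × Fin (M₂ k)) (Fin (M₁ k) × Fin (M₂ k)) ℝ :=
        fun k => SFAC.prec2 σ ε s α₁ α₂ (ht k) (h₁ k) (h₂ k) (M₁ k) (M₂ k)
      let Ahat : ∀ k, Matrix (Fin (M₁ k) × Fin (M₂ k)) (Fin (M₁ k) × Fin (M₂ k)) ℝ :=
        fun k => (γ k)⁻¹ • A k
      let Phat : ∀ k, Matrix (Fin (M₁ k) × Fin (M₂ k)) (Fin (M₁ k) × Fin (M₂ k)) ℝ :=
        fun k => (γ k)⁻¹ • P k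
      SFAC.ZeroDistributed 2 (fun k => SFAC.toComplex (A k - P k)) ∧
      SFAC.ZeroDistributed 2 (fun k => SFAC.toComplex (Ahat k - Phat k)) ∧
      (∀ᶠ k in atTop, IsUnit (P k) ∧ IsUnit (Phat k)) ∧
      SFAC.WeaklyClusteredAt (fun k => SFAC.toComplex ((P k)⁻¹ * A k)) 1 ∧
      SFAC.WeaklyClusteredAt (fun k => SFAC.toComplex ((Phat k)⁻¹ * Ahat k)) 1) := by
  refine ⟨?_, ?_⟩
  · intro α a b h1 h2 hab M N hM hN hMt hNt
    dsimp only
    have : ∀ k, Nonempty (Fin (M k)) := fun k => ⟨⟨0, hM k⟩⟩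
    have hht : ∀ k, 0 < SFAC.timeStep T (N k) := fun k => SFAC.timeStep_pos hT (hN k)
    have hγ : ∀ k, 0 < SFAC.gam α (SFAC.timeStep T (N k)) (SFAC.spaceStep a b (M k)) :=
      fun k => SFAC.gam_pos h1 h2 (hht k) (SFAC.spaceStep_pos hab (M k))
    refine SFAC.preconditioning 1 (fun k => (hγ k).ne')
      (fun k => SFAC.coeff1_isHermitian σ ε s α _ _ _)
      (fun k => SFAC.prec1_isHermitian σ ε s α _ _ _) ?_ ?_ ?_
    · filter_upwards [hMt.eventually_ge_atTop 3] with k hk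
      exact SFAC.prec1_sub_one_posSemidef σ hs h1 h2 (hht k) (SFAC.spaceStep_pos hab _) hk
    · simp only [SFAC.coeff1_sub_prec1]
      exact SFAC.negligible_sub_tau σ h1 h2 hMt (SFAC.tendsto_scaling hT h1 h2 hab hM hNt)
    · simp only [← smul_sub, SFAC.coeff1_sub_prec1]
      simp only [smul_smul, mul_neg]
      refine SFAC.negligible_sub_tau σ h1 h2 hMt
        (SFAC.tendsto_scaling_of_bounded (C := ε ^ 2) h1 hMt fun k => le_of_eq ?_)
      rw [abs_neg, mul_assoc (ε ^ 2), ← SFAC.gam_eq, mul_comm, mul_assoc,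
        mul_inv_cancel₀ (hγ k).ne', mul_one, abs_of_nonneg (sq_nonneg ε)]
  · intro α₁ α₂ a₁ b₁ a₂ b₂ h11 h12 h21 h22 hab₁ hab₂ M₁ M₂ N hM₁ hM₂ hN hMt₁ hMt₂ hNt
    dsimp only
    have : ∀ k, Nonempty (Fin (M₁ k) × Fin (M₂ k)) := fun k => ⟨⟨0, hM₁ k⟩, ⟨0, hM₂ k⟩⟩
    have hht : ∀ k, 0 < SFAC.timeStep T (N k) := fun k => SFAC.timeStep_pos hT (hN k)
    have hγ₁ : ∀ k, 0 < SFAC.gam α₁ (SFAC.timeStep T (N k)) (SFAC.spaceStep a₁ b₁ (M₁ k)) :=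
      fun k => SFAC.gam_pos h11 h12 (hht k) (SFAC.spaceStep_pos hab₁ _)
    have hγ₂ : ∀ k, 0 < SFAC.gam α₂ (SFAC.timeStep T (N k)) (SFAC.spaceStep a₂ b₂ (M₂ k)) :=
      fun k => SFAC.gam_pos h21 h22 (hht k) (SFAC.spaceStep_pos hab₂ _)
    -- Since γ is the maximum of the two directional values, each ratio γ_j/γ is at most 1,
    -- uniformly in k.
    have hbound : ∀ g γ : ℝ, 0 < g → g ≤ γ → |-(γ⁻¹ * (ε ^ 2 * g))| ≤ ε ^ 2 := fun g γ hg hgγ => by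
      have hγ : 0 < γ := hg.trans_le hgγ
      rw [abs_neg, abs_of_nonneg (by positivity), inv_mul_le_iff₀ hγ, mul_comm]
      exact mul_le_mul_of_nonneg_right hgγ (sq_nonneg ε)
    refine SFAC.preconditioning 2 (fun k => (lt_max_of_lt_left (hγ₁ k)).ne')
      (fun k => SFAC.coeff2_isHermitian σ ε s α₁ α₂ _ _ _ _ _)
      (fun k => SFAC.prec2_isHermitian σ ε s α₁ α₂ _ _ _ _ _) ?_ ?_ ?_
    · filter_upwards [hMt₁.eventually_ge_atTop 3, hMt₂.eventually_ge_atTop 3] with k hk₁ hk₂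
      exact SFAC.prec2_sub_one_posSemidef σ hs h11 h12 h21 h22 (hht k)
        (SFAC.spaceStep_pos hab₁ _) (SFAC.spaceStep_pos hab₂ _) hk₁ hk₂
    · simp only [SFAC.coeff2_sub_prec2]
      exact (SFAC.negligible_sub_tau σ h11 h12 hMt₁
        (SFAC.tendsto_scaling hT h11 h12 hab₁ hM₁ hNt)).kronecker_sum
        (SFAC.negligible_sub_tau σ h21 h22 hMt₂ (SFAC.tendsto_scaling hT h21 h22 hab₂ hM₂ hNt))
    · simp only [← smul_sub, SFAC.smul_coeff2_sub_prec2]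
      exact (SFAC.negligible_sub_tau σ h11 h12 hMt₁ (SFAC.tendsto_scaling_of_bounded h11 hMt₁
        fun k => hbound _ _ (hγ₁ k) (le_max_left _ _))).kronecker_sum
        (SFAC.negligible_sub_tau σ h21 h22 hMt₂ (SFAC.tendsto_scaling_of_bounded h21 hMt₂
          fun k => hbound _ _ (hγ₂ k) (le_max_right _ _)))
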